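/- Let $n\ge 1$, let $\Omega\subset\mathbb C^n$ be a non-empty connected open set, and let $H\neq\{0\}$ be a complex Hilbert space whose elements are holomorphic functions on $\Omega$ (with pointwise operations), such that for every $z\in\Omega$ the point evaluation $f\mapsto f(z)$ is a bounded functional on $H$. A function $\psi:\Omega\to\mathbb C$ is a multiplier of $H$ if $\psi f\in H$ for every $f\in H$; then $M_\psi:H\to H$, $M_\psi f=\psi f$, is a bounded linear operator. Suppose that every non-constant bounded holomorphic function $\psi$ on $\Omega$ is a multiplier of $H$ with $\|M_\psi\|=\|\psi\|_\infty:=\sup_{z\in\Omega}|\psi(z)|$. Then for each non-constant bounded holomorphic function $\phi$ on $\Omega$, with $T:=M_\phi^*$ the Hilbert space adjoint of $M_\phi$, the following are equivalent: (i) $T$ is topologically multiply recurrent: for every non-empty open $U\subset H$ and every integer $m\ge1$ there is an integer $k\ge1$ with $U\cap T^{-k}U\cap\dots\cap T^{-mk}U\neq\emptyset$. (ii) $T$ is recurrent: for every non-empty open $U\subset H$ there is an integer $k\ge1$ with $U\cap T^{-k}U\neq\emptyset$. (iii) $T$ is frequently hypercyclic: there is $x\in H$ such that for every non-empty open $U\subset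 H$ the set $\{n\ge 1: T^nx\in U\}$ has positive lower density. (iv) $T$ is hypercyclic: there is $x\in H$ whose orbit $\{T^nx: n=0,1,2,\dots\}$ is dense in $H$. (v) $\phi(\Omega)\cap\mathbb T\neq\emptyset$, where $\mathbb T=\{w\in\mathbb C:|w|=1\}$. (vi) $T$ has property $\mathcal A$: for every non-empty open $U\subset H$ there is $x\in H$ such that the set $\{n\ge 1: T^nx\in U\}$ has positive upper density. Here the lower and upper densities of a set $B$ of positive integers are $\liminf_{N\to\infty}|B\cap[1,N]|/N$ and $\limsup_{N\to\infty}|B\cap[1,N]|/N$. -/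

import Mathlib

open Filter Topology

noncomputable section

namespace LinDyn

/-! ### Densities of sets of positive integers -/

/-- Lower density: `liminf_{N → ∞} |{n ∈ B : 1 ≤ n ≤ N}| / N`. The quotients lie in `[0, 1]`. -/
def lowerDensity (B : Set ℕ) : ℝ :=
  liminf (fun N : ℕ => ((B ∩ Set.Icc 1 N).ncard : ℝ) / (N : ℝ)) atTop

/-- Upper density: `limsup_{N → ∞} |{n ∈ B : 1 ≤ n ≤ N}| / N`. The quotients lie in `[0, 1]`. -/
def upperDensity (B : Set ℕ) : ℝ :=
  limsup (fun N : ℕ => ((B ∩ Set.Icc 1 N).ncard : ℝ) / (N : ℝ)) atTop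

/-! ### Dynamical properties of a bounded linear operator -/

section Operators

variable {X : Type*} [NormedAddCommGroup X] [NormedSpace ℂ X]

/-- Some vector has a dense orbit `{T ^ n x : n = 0, 1, 2, …}`. -/
def Hypercyclic (T : X →L[ℂ] X) : Prop :=
  ∃ x : X, Dense (Set.range fun n : ℕ => (T ^ n) x)

/-- Some vector visits every non-empty open set along a set of times of positive lower density. -/
def FrequentlyHypercyclic (T : X →L[ℂ] X) : Prop :=
  ∃ x : X, ∀ U : Set X, IsOpen U → U.Nonempty → 0 < lowerDensity {n : ℕ | (T ^ n) x ∈ U}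

/-- For every non-empty open `U` there is `k ≥ 1` with `U ∩ T ^ (-k) U ≠ ∅`. -/
def Recurrent (T : X →L[ℂ] X) : Prop :=
  ∀ U : Set X, IsOpen U → U.Nonempty → ∃ k : ℕ, 0 < k ∧ (U ∩ (fun x => (T ^ k) x) ⁻¹' U).Nonempty

/-- For every non-empty open `U` and `m ≥ 1` there is `k ≥ 1` with
`U ∩ T ^ (-k) U ∩ ⋯ ∩ T ^ (-m k) U ≠ ∅`. -/
def TopologicallyMultiplyRecurrent (T : X →L[ℂ] X) : Prop :=
  ∀ U : Set X, IsOpen U → U.Nonempty → ∀ m : ℕ, 0 < m →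
    ∃ k : ℕ, 0 < k ∧ (U ∩ ⋂ j ∈ Set.Icc 1 m, (fun x => (T ^ (j * k)) x) ⁻¹' U).Nonempty

/-- For every non-empty open `U` some vector visits `U` along a set of times of positive
upper density. -/
def HasPropertyA (T : X →L[ℂ] X) : Prop :=
  ∀ U : Set X, IsOpen U → U.Nonempty → ∃ x : X, 0 < upperDensity {n : ℕ | (T ^ n) x ∈ U}

end Operators

/-! ### Holomorphic functions and multipliers -/

/-- A function on `Ω ⊆ ℂⁿ` is holomorphic: it is the restriction of a function on `ℂⁿ` which is
complex differentiable on `Ω` (used for open `Ω`; the values outside `Ω` are irrelevant). -/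
def IsHolomorphic {n : ℕ} (Ω : Set (EuclideanSpace ℂ (Fin n))) (f : Ω → ℂ) : Prop :=
  ∃ F : EuclideanSpace ℂ (Fin n) → ℂ, DifferentiableOn ℂ F Ω ∧ ∀ z : Ω, F z = f z

/-- Non-constant bounded holomorphic functions on `Ω`. -/
structure IsNonconstBddHolomorphic {n : ℕ} (Ω : Set (EuclideanSpace ℂ (Fin n)))
    (φ : Ω → ℂ) : Prop where
  holomorphic : IsHolomorphic Ω φ
  bounded : BddAbove (Set.range fun z : Ω => ‖φ z‖)
  nonconstant : ∃ z w : Ω, φ z ≠ φ w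

section Multipliers

variable {S : Type*} (H : Type*) [NormedAddCommGroup H] [InnerProductSpace ℂ H] [RKHS ℂ H S ℂ]

/-- `φ` is a multiplier of the function space `H`: `φ f ∈ H` for every `f ∈ H`. -/
def IsMultiplier (φ : S → ℂ) : Prop :=
  ∀ f : H, ∃ g : H, ∀ z : S, g z = φ z * f z

variable {H}

/-- The multiplication operator as a linear map. -/
def mulLinear (φ : S → ℂ) (h : IsMultiplier H φ) : H →ₗ[ℂ] H where
  toFun f := (h f).choose
  map_add' f g := by
    ext z
    rw [(h (f + g)).choose_spec z, RKHS.coe_add, RKHS.coe_add, Pi.add_apply, Pi.add_apply,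
      (h f).choose_spec z, (h g).choose_spec z, mul_add]
  map_smul' c f := by
    ext z
    rw [(h (c • f)).choose_spec z, RKHS.coe_smul, RingHom.id_apply, RKHS.coe_smul, Pi.smul_apply,
      Pi.smul_apply, (h f).choose_spec z, smul_eq_mul, smul_eq_mul, mul_left_comm]

theorem mulLinear_apply (φ : S → ℂ) (h : IsMultiplier H φ) (f : H) (z : S) :
    mulLinear φ h f z = φ z * f z :=
  (h f).choose_spec z

/-- The multiplication operator `M_φ f = φ f` of a multiplier `φ`, as a bounded operator on `H`
(it is bounded by the closed graph theorem). -/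
def mulOp [CompleteSpace H] (φ : S → ℂ) (h : IsMultiplier H φ) : H →L[ℂ] H :=
  ContinuousLinearMap.ofSeqClosedGraph (g := mulLinear φ h) (by
    intro u x y hu hv
    ext z
    have h1 : Tendsto (fun k => mulLinear φ h (u k) z) atTop (𝓝 (y z)) :=
      ((RKHS.continuous_eval z).tendsto y).comp hv
    have h2 : Tendsto (fun k => φ z * u k z) atTop (𝓝 (φ z * x z)) :=
      (((RKHS.continuous_eval z).tendsto x).comp hu).const_mul (φ z)
    simp only [mulLinear_apply] at h1
    rw [mulLinear_apply]
    exact tendsto_nhds_unique h1 h2)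

theorem mulOp_apply [CompleteSpace H] (φ : S → ℂ) (h : IsMultiplier H φ) (f : H) (z : S) :
    mulOp φ h f z = φ z * f z :=
  mulLinear_apply φ h f z

end Multipliers

end LinDyn

end

/-!
Write `k_z` for the reproducing kernel at `z` and `T` for the adjoint of `M_φ`, so that
`T k_z = conj (φ z) k_z`.

Each of the dynamical properties implies recurrence, and recurrence forces a unimodular value: if
`|φ|` avoids `1`, then, `Ω` being connected, `|φ| < 1` or `|φ| > 1` throughout. In the first case `T`
is a contraction, in the second it has a contractive left inverse, the adjoint of `M_{1/φ}`, which
is recurrent as well. A recurrent contraction cannot have a non-zero eigenvector `k_z` with an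
eigenvalue in the open unit disc (`Recurrent.not_contraction_of_eigenvector`).

Conversely, let `φ` have a unimodular value. There are holomorphic discs `γ` in `Ω` along which
`φ (γ ζ) = exp (i ζ)`, and these charts are a set of uniqueness
(`eq_zero_of_frequently_eq_zero_on_charts`). Two dense sets of vectors come out of this.

* The `k_z` for which `φ z` is a root of unity span a dense space of periodic vectors
  (`dense_periodic`). This gives multiple recurrence and property `𝒜`; Szemerédi's theorem is not
  needed.
* Averages of the `k_z` over the arcs `γ θ`, `a ≤ θ ≤ b`, with a weight that has double zeros at
  `a` and `b`, have two-sided orbits with norms `O(1 / k²)`, by two partial integrations for each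
  `f ∈ H` and the uniform boundedness principle. They span a dense space as well
  (`dense_summableOrbits`).

In a separable space the second fact gives frequent hypercyclicity
(`frequentlyHypercyclic_of_summable_orbits`). List points `z_j` of a dense set, each infinitely often,
with summable orbits `z_j(k)`, and put `x = ∑ j, ∑ n ∈ A_j, z_j(-n)`. If the sets `A_j` have positive
lower density and are far enough apart (`exists_separated_sets`), then `T ^ m x` is close to `z_j(0)`
for all `m ∈ A_j`.
-/

namespace LinDyn

/-! ### Densities -/

theorem count_div_nonneg (B : Set ℕ) (N : ℕ) :
    0 ≤ ((B ∩ Set.Icc 1 N).ncard : ℝ) / (N : ℝ) := by positivity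

theorem count_div_le_one (B : Set ℕ) (N : ℕ) :
    ((B ∩ Set.Icc 1 N).ncard : ℝ) / (N : ℝ) ≤ 1 := by
  have h : (B ∩ Set.Icc 1 N).ncard ≤ N := by
    have h1 := Set.ncard_le_ncard (Set.inter_subset_right : B ∩ Set.Icc 1 N ⊆ Set.Icc 1 N)
      (Set.finite_Icc 1 N)
    simpa [Set.ncard_eq_toFinset_card'] using h1
  exact div_le_one_of_le₀ (by exact_mod_cast h) (by positivity)

theorem isBoundedUnder_le_count_div (B : Set ℕ) :
    IsBoundedUnder (· ≤ ·) atTop (fun N : ℕ => ((B ∩ Set.Icc 1 N).ncard : ℝ) / (N : ℝ)) :=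
  isBoundedUnder_of ⟨1, count_div_le_one B⟩

theorem isBoundedUnder_ge_count_div (B : Set ℕ) :
    IsBoundedUnder (· ≥ ·) atTop (fun N : ℕ => ((B ∩ Set.Icc 1 N).ncard : ℝ) / (N : ℝ)) :=
  isBoundedUnder_of ⟨0, count_div_nonneg B⟩

theorem lowerDensity_le_upperDensity (B : Set ℕ) : lowerDensity B ≤ upperDensity B :=
  liminf_le_limsup (isBoundedUnder_le_count_div B) (isBoundedUnder_ge_count_div B)

theorem lowerDensity_mono {A B : Set ℕ} (h : A ⊆ B) : lowerDensity A ≤ lowerDensity B := by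
  refine liminf_le_liminf (Eventually.of_forall fun N => ?_) (isBoundedUnder_ge_count_div A)
    (isBoundedUnder_le_count_div B).isCoboundedUnder_ge
  have := Set.ncard_le_ncard (Set.inter_subset_inter_left (Set.Icc 1 N) h)
    ((Set.finite_Icc 1 N).inter_of_right B)
  gcongr

theorem lowerDensity_pos_of_eventually_le {B : Set ℕ} {c : ℝ} (hc : 0 < c)
    (h : ∀ᶠ N : ℕ in atTop, c * N ≤ ((B ∩ Set.Icc 1 N).ncard : ℝ)) : 0 < lowerDensity B := by
  refine hc.trans_le (le_liminf_of_le (isBoundedUnder_le_count_div B).isCoboundedUnder_ge ?_)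
  filter_upwards [h, eventually_gt_atTop 0] with N hN hN0
  rwa [le_div_iff₀ (by exact_mod_cast hN0)]

/-- A set which contains the values of an injective positive sequence of linear growth has positive
lower density. -/
theorem lowerDensity_pos_of_linear_growth {B : Set ℕ} {u : ℕ → ℕ} (hu : Function.Injective u)
    (huB : ∀ m, u m ∈ B) (hpos : ∀ m, 0 < u m) {C : ℕ} (hC : 0 < C)
    (hgrowth : ∀ m, u m ≤ C * (m + 1)) : 0 < lowerDensity B := by
  have hC' : (0 : ℝ) < C := by exact_mod_cast hC
  refine lowerDensity_pos_of_eventually_le (c := 1 / (2 * C)) (by positivity) ?_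
  filter_upwards [eventually_ge_atTop (2 * C)] with N hN
  have h1 : N / C ≤ (B ∩ Set.Icc 1 N).ncard := by
    calc N / C = ((Finset.range (N / C)).image u : Set ℕ).ncard := by
          rw [Set.ncard_coe_finset, Finset.card_image_of_injective _ hu, Finset.card_range]
      _ ≤ _ := by
          refine Set.ncard_le_ncard ?_ ((Set.finite_Icc 1 N).inter_of_right B)
          intro x hx
          simp only [Finset.coe_image, Finset.coe_range, Set.mem_image, Set.mem_Iio] at hx
          obtain ⟨m, hm, rfl⟩ := hx
          refine ⟨huB m, hpos m, (hgrowth m).trans ?_⟩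
          calc C * (m + 1) ≤ C * (N / C) := Nat.mul_le_mul_left _ hm
            _ ≤ N := Nat.mul_div_le N C
  have h2 : (N : ℝ) / C < (N / C : ℕ) + 1 := by
    rw [div_lt_iff₀ hC']
    exact_mod_cast Nat.lt_mul_of_div_lt (Nat.lt_succ_self (N / C)) hC
  have h3 : (2 : ℝ) ≤ N / C := by
    rw [le_div_iff₀ hC']
    exact_mod_cast hN
  have h4 : ((N / C : ℕ) : ℝ) ≤ ((B ∩ Set.Icc 1 N).ncard : ℝ) := by exact_mod_cast h1
  have h5 : 1 / (2 * C) * (N : ℝ) = (N / C) / 2 := by field_simp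
  linarith

theorem infinite_of_upperDensity_pos {B : Set ℕ} (h : 0 < upperDensity B) : B.Infinite := by
  intro hB
  have h1 : Tendsto (fun N : ℕ => (B.ncard : ℝ) / (N : ℝ)) atTop (𝓝 0) :=
    tendsto_const_nhds.div_atTop tendsto_natCast_atTop_atTop
  have h2 : Tendsto (fun N : ℕ => ((B ∩ Set.Icc 1 N).ncard : ℝ) / (N : ℝ)) atTop (𝓝 0) := by
    refine squeeze_zero (count_div_nonneg B) (fun N => ?_) h1
    have := Set.ncard_le_ncard (Set.inter_subset_left : B ∩ Set.Icc 1 N ⊆ B) hB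
    gcongr
  exact h.ne' h2.limsup_eq

/-! ### Widely separated sets of positive lower density -/

/-- The weight of `l`: the sum of those gap lengths `N j`, `j < l`, for which `2 ^ (j + N j)`
divides `l`. -/
def gapWeight (N : ℕ → ℕ) (l : ℕ) : ℕ :=
  ∑ j ∈ Finset.range l with 2 ^ (j + N j) ∣ l, N j

/-- The positions: consecutive positions `gapPosition N l`, `gapPosition N (l + 1)` are at distance
`gapWeight N l + gapWeight N (l + 1)`. -/
def gapPosition (N : ℕ → ℕ) (k : ℕ) : ℕ :=
  ∑ l ∈ Finset.range k, gapWeight N l + ∑ l ∈ Finset.range (k + 1), gapWeight N l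

theorem le_gapWeight (N : ℕ → ℕ) (j m : ℕ) :
    N j ≤ gapWeight N (2 ^ (j + N j) * (2 * m + 1)) := by
  refine Finset.single_le_sum (f := N) (fun _ _ => Nat.zero_le _) ?_
  rw [Finset.mem_filter, Finset.mem_range]
  refine ⟨?_, dvd_mul_right _ _⟩
  calc j < 2 ^ j := Nat.lt_two_pow_self
    _ ≤ 2 ^ (j + N j) := Nat.pow_le_pow_right (by norm_num) (by omega)
    _ ≤ _ := Nat.le_mul_of_pos_right _ (by omega)

/-- The multiples of `2 ^ (j + N j)` have frequency `2⁻ʲ / 2 ^ N j`, which makes the average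
contribution of `N j` to the weights at most `2⁻ʲ`. -/
theorem sum_gapWeight_le (N : ℕ → ℕ) (k : ℕ) :
    ∑ l ∈ Finset.range (k + 1), gapWeight N l ≤ 2 * k := by
  have h0 : ∑ l ∈ Finset.range (k + 1), gapWeight N l = ∑ l ∈ Finset.Ioc 0 k, gapWeight N l := by
    rw [Finset.sum_range_eq_add_Ico _ (by omega)]
    have : gapWeight N 0 = 0 := by simp [gapWeight]
    rw [this, zero_add]
    rfl
  have h1 : ∑ l ∈ Finset.Ioc 0 k, gapWeight N l ≤ ∑ j ∈ Finset.range k, k / 2 ^ j := by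
    calc ∑ l ∈ Finset.Ioc 0 k, gapWeight N l
        ≤ ∑ l ∈ Finset.Ioc 0 k, ∑ j ∈ Finset.range k, if 2 ^ (j + N j) ∣ l then N j else 0 := by
          refine Finset.sum_le_sum fun l hl => ?_
          rw [gapWeight, Finset.sum_filter]
          exact Finset.sum_le_sum_of_subset
            (Finset.range_mono (Finset.mem_Ioc.1 hl).2)
      _ = ∑ j ∈ Finset.range k, k / 2 ^ (j + N j) * N j := by
          rw [Finset.sum_comm]
          refine Finset.sum_congr rfl fun j _ => ?_
          rw [← Finset.sum_filter, Finset.sum_const, Nat.Ioc_filter_dvd_card_eq_div, smul_eq_mul]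
      _ ≤ ∑ j ∈ Finset.range k, k / 2 ^ j := by
          refine Finset.sum_le_sum fun j _ => ?_
          rw [pow_add, ← Nat.div_div_eq_div_mul]
          calc k / 2 ^ j / 2 ^ N j * N j ≤ k / 2 ^ j / 2 ^ N j * 2 ^ N j :=
                Nat.mul_le_mul_left _ Nat.lt_two_pow_self.le
            _ ≤ _ := Nat.div_mul_le_self _ _
  have h2 : (∑ j ∈ Finset.range k, k / 2 ^ j) ≤ k * 2 / (2 - 1) := by
    have := Nat.geom_sum_le (b := 2) le_rfl k k
    exact this
  rw [h0]
  omega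

theorem gapPosition_le (N : ℕ → ℕ) (k : ℕ) : gapPosition N k ≤ 4 * k := by
  have h1 := sum_gapWeight_le N k
  have h2 : ∑ l ∈ Finset.range k, gapWeight N l ≤ ∑ l ∈ Finset.range (k + 1), gapWeight N l :=
    Finset.sum_le_sum_of_subset (Finset.range_mono (by omega))
  rw [gapPosition]
  omega

theorem gapWeight_le_gapPosition (N : ℕ → ℕ) (k : ℕ) : gapWeight N k ≤ gapPosition N k := by
  rw [gapPosition, Finset.sum_range_succ]
  omega

theorem gapPosition_add_le (N : ℕ → ℕ) {k l : ℕ} (h : l < k) :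
    gapPosition N l + gapWeight N l + gapWeight N k ≤ gapPosition N k := by
  have h1 : ∑ i ∈ Finset.range (l + 1), gapWeight N i ≤ ∑ i ∈ Finset.range k, gapWeight N i :=
    Finset.sum_le_sum_of_subset (Finset.range_mono h)
  rw [Finset.sum_range_succ] at h1
  simp only [gapPosition, Finset.sum_range_succ]
  omega

/-- For any prescribed gap lengths `N j` there are sets `A j` of positive lower density such
that `A j` lies beyond `N j` and distinct points of `A i` and `A j` are at least
`N (max i j)` apart. -/
theorem exists_separated_sets (N : ℕ → ℕ) (hN : Monotone N) (hpos : ∀ j, 0 < N j) :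
    ∃ A : ℕ → Set ℕ, (∀ j, 0 < lowerDensity (A j)) ∧ (∀ j, ∀ n ∈ A j, N j ≤ n) ∧
      ∀ i j, ∀ m ∈ A i, ∀ n ∈ A j, ¬(i = j ∧ m = n) → N (max i j) ≤ ((m : ℤ) - n).natAbs := by
  -- The indices `2 ^ (j + N j) * (2 * m + 1)`, those of 2-adic valuation `j + N j`, get colour `j`.
  have hgap : ∀ i j a b, i ≠ j ∨ a ≠ b → N (max i j) ≤
      ((gapPosition N (2 ^ (i + N i) * (2 * a + 1)) : ℤ) -
        gapPosition N (2 ^ (j + N j) * (2 * b + 1))).natAbs := by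
    intro i j a b hne
    have hi := le_gapWeight N i a
    have hj := le_gapWeight N j b
    have hmax : N (max i j) ≤ N i + N j := by
      rcases max_choice i j with h | h <;> rw [h] <;> omega
    have hkl : 2 ^ (i + N i) * (2 * a + 1) ≠ 2 ^ (j + N j) * (2 * b + 1) := by
      intro heq
      have hexp : i + N i = j + N j := by
        have h2 : ∀ e c : ℕ, padicValNat 2 (2 ^ e * (2 * c + 1)) = e := by
          intro e c
          rw [padicValNat.mul (by positivity) (by omega), padicValNat.prime_pow,
            padicValNat.eq_zero_of_not_dvd (by omega), add_zero]
        have h3 := h2 (i + N i) a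
        rw [heq, h2] at h3
        exact h3.symm
      have hij : i = j := by
        rcases lt_trichotomy i j with h | h | h
        · have := hN h.le
          omega
        · exact h
        · have := hN h.le
          omega
      subst hij
      have hab := Nat.eq_of_mul_eq_mul_left (by positivity) heq
      rcases hne with h | h
      · exact h rfl
      · exact h (by omega)
    rcases lt_or_gt_of_ne hkl with h | h
    · have := gapPosition_add_le N h
      omega
    · have := gapPosition_add_le N h
      omega
  refine ⟨fun j => Set.range fun m => gapPosition N (2 ^ (j + N j) * (2 * m + 1)), fun j => ?_,
    ?_, ?_⟩
  · have hle : ∀ m, N j ≤ gapPosition N (2 ^ (j + N j) * (2 * m + 1)) := fun m =>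
      (le_gapWeight N j m).trans (gapWeight_le_gapPosition N _)
    refine lowerDensity_pos_of_linear_growth
      (u := fun m => gapPosition N (2 ^ (j + N j) * (2 * m + 1))) (C := 8 * 2 ^ (j + N j))
      (fun a b hab => ?_) (fun m => ⟨m, rfl⟩) (fun m => (hpos j).trans_le (hle m)) (by positivity)
      (fun m => (gapPosition_le N _).trans ?_)
    · by_contra hne
      have h1 := hgap j j a b (Or.inr hne)
      have h2 := hpos j
      simp only at hab
      rw [hab, max_self] at h1
      omega
    · nlinarith [Nat.zero_le (2 ^ (j + N j))]
  · rintro j _ ⟨m, rfl⟩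
    exact (le_gapWeight N j m).trans (gapWeight_le_gapPosition N _)
  · rintro i j _ ⟨a, rfl⟩ _ ⟨b, rfl⟩ hne
    refine hgap i j a b ?_
    by_contra! h
    exact hne ⟨h.1, by rw [h.1, h.2]⟩

/-! ### A frequent hypercyclicity criterion -/

section Criterion

variable {X : Type*} [NormedAddCommGroup X]

/-- The sum of the norms `‖y k‖` over the integers `k` with `K ≤ |k|`. -/
noncomputable def normTail (y : ℤ → X) (K : ℕ) : ℝ :=
  ∑' k : ℤ, Set.indicator {k : ℤ | K ≤ k.natAbs} (fun k => ‖y k‖) k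

theorem normTail_antitone {y : ℤ → X} (hy : Summable fun k => ‖y k‖) : Antitone (normTail y) := by
  intro K L hKL
  refine Summable.tsum_le_tsum (fun k => ?_) (hy.indicator _) (hy.indicator _)
  exact Set.indicator_le_indicator_of_subset (s := {k : ℤ | L ≤ k.natAbs})
    (t := {k : ℤ | K ≤ k.natAbs}) (f := fun k => ‖y k‖)
    (fun k hk => hKL.trans hk) (fun _ => norm_nonneg _) k

theorem exists_normTail_le {y : ℤ → X} (hy : Summable fun k => ‖y k‖) {ε : ℝ} (hε : 0 < ε) :
    ∃ K, normTail y K ≤ ε := by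
  obtain ⟨s, hs⟩ := summable_iff_vanishing_norm.1 hy ε hε
  refine ⟨s.sup Int.natAbs + 1, (hy.indicator _).tsum_le_of_sum_le fun t => ?_⟩
  classical
  have h1 : ∑ k ∈ t, Set.indicator {k : ℤ | s.sup Int.natAbs + 1 ≤ k.natAbs} (fun k => ‖y k‖) k =
      ∑ k ∈ t with s.sup Int.natAbs + 1 ≤ k.natAbs, ‖y k‖ :=
    Finset.sum_indicator_eq_sum_filter t (fun _ k => ‖y k‖)
      (fun _ => {k : ℤ | s.sup Int.natAbs + 1 ≤ k.natAbs}) id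
  rw [h1]
  refine (le_abs_self _).trans (hs _ ?_).le
  rw [Finset.disjoint_left]
  intro k hk hks
  have h3 := (Finset.mem_filter.1 hk).2
  have h4 := Finset.le_sup (f := Int.natAbs) hks
  omega

theorem summable_and_tsum_le_normTail {y : ℤ → X} (hy : Summable fun k => ‖y k‖) (m : ℤ)
    (P : Set ℕ) (K : ℕ) (hP : ∀ n ∈ P, K ≤ (m - n).natAbs) :
    Summable (fun n : ℕ => P.indicator (fun n => ‖y (m - n)‖) n) ∧
      ∑' n : ℕ, P.indicator (fun n => ‖y (m - n)‖) n ≤ normTail y K := by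
  have hinj : Function.Injective fun n : ℕ => m - (n : ℤ) := fun a b h => by
    simp only at h
    omega
  have hs : Summable (fun n : ℕ => P.indicator (fun n => ‖y (m - n)‖) n) :=
    (hy.comp_injective hinj).indicator P
  refine ⟨hs, hs.tsum_le_tsum_of_inj _ hinj (fun k _ => ?_) (fun n => ?_) (hy.indicator _)⟩
  · exact Set.indicator_nonneg (fun _ _ => norm_nonneg _) k
  · by_cases hn : n ∈ P
    · rw [Set.indicator_of_mem hn,
        Set.indicator_of_mem (s := {k : ℤ | K ≤ k.natAbs}) (hP n hn) (fun k => ‖y k‖)]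
    · rw [Set.indicator_of_notMem hn]
      exact Set.indicator_nonneg (s := {k : ℤ | K ≤ k.natAbs}) (f := fun k => ‖y k‖)
        (fun _ _ => norm_nonneg _) _

/-- For countably many summable sequences there are gap lengths beyond which the tails decay
geometrically, jointly in the index of the sequence and in the index of the gap length. -/
theorem exists_gaps (z : ℕ → ℤ → X) (hz : ∀ j, Summable fun k => ‖z j k‖) :
    ∃ N : ℕ → ℕ, Monotone N ∧ (∀ j, 0 < N j) ∧
      ∀ i j, normTail (z j) (N (max i j)) ≤ (1 / 2) ^ i * (1 / 2) ^ j := by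
  choose K hK using fun i j => exists_normTail_le (hz j) (ε := (1 / 4) ^ i) (by positivity)
  refine ⟨fun i => ∑ l ∈ Finset.range (i + 1), (∑ j ∈ Finset.range (l + 1), K l j + 1), ?_, ?_, ?_⟩
  · intro a b hab
    exact Finset.sum_le_sum_of_subset (Finset.range_mono (by omega))
  · intro j
    exact Finset.sum_pos (fun _ _ => by omega) ⟨0, by simp⟩
  · intro i j
    set M := max i j with hM
    have h1 : K M j ≤ ∑ l ∈ Finset.range (M + 1), (∑ j ∈ Finset.range (l + 1), K l j + 1) := by
      calc K M j ≤ ∑ j ∈ Finset.range (M + 1), K M j :=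
            Finset.single_le_sum (f := K M) (fun _ _ => Nat.zero_le _)
              (Finset.mem_range.2 (by omega))
        _ ≤ ∑ j ∈ Finset.range (M + 1), K M j + 1 := Nat.le_succ _
        _ ≤ _ := Finset.single_le_sum (f := fun l => ∑ j ∈ Finset.range (l + 1), K l j + 1)
              (fun _ _ => Nat.zero_le _) (Finset.mem_range.2 (by omega))
    calc normTail (z j) _ ≤ normTail (z j) (K M j) := normTail_antitone (hz j) h1
      _ ≤ (1 / 4) ^ M := hK M j
      _ = (1 / 2) ^ M * (1 / 2) ^ M := by rw [← mul_pow]; norm_num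
      _ ≤ (1 / 2) ^ i * (1 / 2) ^ j := by
        gcongr ?_ * ?_ <;> exact pow_le_pow_of_le_one (by norm_num) (by norm_num) (by omega)

variable [NormedSpace ℂ X] [CompleteSpace X]

/-- If an operator has countably many two-sided orbits which are absolutely summable and
whose points at time `0` are dense, then it is frequently hypercyclic: a frequently hypercyclic
vector is `∑ j, ∑ n ∈ A j, z j (-n)` for widely separated sets `A j`, where `z` lists every one of
the orbits infinitely often. -/
theorem frequentlyHypercyclic_of_summable_orbits (T : X →L[ℂ] X) (y : ℕ → ℤ → X)
    (hT : ∀ j k, T (y j k) = y j (k + 1)) (hs : ∀ j, Summable fun k => ‖y j k‖)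
    (hd : DenseRange fun j => y j 0) : FrequentlyHypercyclic T := by
  set z : ℕ → ℤ → X := fun j => y j.unpair.1 with hz_def
  have hz : ∀ j, Summable fun k => ‖z j k‖ := fun j => hs _
  have hTz : ∀ (m : ℕ) j k, (T ^ m) (z j k) = z j (m + k) := by
    intro m j k
    induction m with
    | zero => simp
    | succ m ih =>
      rw [pow_succ', mul_apply_eq_comp, ih, hz_def]
      simp only [hT]
      congr 1
      push_cast
      ring
  obtain ⟨N, hN, hNpos, htail⟩ := exists_gaps z hz
  obtain ⟨A, hAd, hAN, hAsep⟩ := exists_separated_sets N hN hNpos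
  have key : ∀ (i : ℕ) (m : ℤ) (P : ℕ → Set ℕ),
      (∀ j, ∀ n ∈ P j, N (max i j) ≤ (m - n).natAbs) →
      Summable (fun p : ℕ × ℕ => ‖(P p.1).indicator (fun n => z p.1 (m - n)) p.2‖) ∧
      ∑' p : ℕ × ℕ, ‖(P p.1).indicator (fun n => z p.1 (m - n)) p.2‖ ≤ 2 * (1 / 2) ^ i := by
    intro i m P hP
    have h1 := fun j => summable_and_tsum_le_normTail (hz j) m (P j) (N (max i j)) (hP j)
    simp only [norm_indicator_eq_indicator_norm]
    have hgeo : Summable fun j : ℕ => ((1 : ℝ) / 2) ^ i * (1 / 2) ^ j :=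
      summable_geometric_two.mul_left _
    have h2 : Summable fun j : ℕ => ∑' n : ℕ, (P j).indicator (fun n => ‖z j (m - n)‖) n :=
      Summable.of_nonneg_of_le
        (fun j => tsum_nonneg fun n => Set.indicator_nonneg (fun _ _ => norm_nonneg _) n)
        (fun j => (h1 j).2.trans (htail i j)) hgeo
    have h3 : Summable (fun p : ℕ × ℕ => (P p.1).indicator (fun n => ‖z p.1 (m - n)‖) p.2) :=
      (summable_prod_of_nonneg fun p => Set.indicator_nonneg (fun _ _ => norm_nonneg _) p.2).2
        ⟨fun j => (h1 j).1, h2⟩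
    refine ⟨h3, ?_⟩
    rw [h3.tsum_prod]
    calc ∑' j : ℕ, ∑' n : ℕ, (P j).indicator (fun n => ‖z j (m - n)‖) n
        ≤ ∑' j : ℕ, ((1 : ℝ) / 2) ^ i * (1 / 2) ^ j :=
          h2.tsum_le_tsum (fun j => (h1 j).2.trans (htail i j)) hgeo
      _ = 2 * (1 / 2) ^ i := by rw [tsum_mul_left, tsum_geometric_two, mul_comm]
  set g : ℕ × ℕ → X := fun p => (A p.1).indicator (fun n => z p.1 (0 - n)) p.2 with hg_def
  have hg : Summable g := by
    refine (key 0 0 A fun j n hn => ?_).1.of_norm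
    have := hAN j n hn
    simp only [Nat.zero_max]
    omega
  set x : X := ∑' p, g p with hx_def
  -- At a time `m ∈ A i` all terms of `T ^ m x` but the term `z i 0` of index `(i, m)` are small.
  have hclose : ∀ i, ∀ m ∈ A i, ‖(T ^ m) x - z i 0‖ ≤ 2 * (1 / 2) ^ i := by
    intro i m hm
    obtain ⟨h1, h2⟩ := key i m (fun j => A j \ {n | i = j ∧ m = n}) fun j n hn =>
      hAsep i j m hm n hn.1 hn.2
    set q : ℕ × ℕ → X := fun p =>
      (A p.1 \ {n | i = p.1 ∧ m = n}).indicator (fun n => z p.1 (m - n)) p.2 with hq_def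
    have hq : HasSum q ((T ^ m) x - z i 0) := by
      have h3 : HasSum (fun p => (T ^ m) (g p)) ((T ^ m) x) := (T ^ m).hasSum hg.hasSum
      have h4 : HasSum (fun p : ℕ × ℕ => if p = (i, m) then z i 0 else 0) (z i 0) :=
        hasSum_ite_eq _ _
      convert h3.sub h4 using 2 with p
      obtain ⟨j, n⟩ := p
      have hTg : (T ^ m) (g (j, n)) = (A j).indicator (fun n => z j (m - n)) n := by
        simp only [hg_def]
        by_cases hn : n ∈ A j
        · rw [Set.indicator_of_mem hn, Set.indicator_of_mem hn, hTz]
          congr 1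
          ring
        · rw [Set.indicator_of_notMem hn, Set.indicator_of_notMem hn, map_zero]
      rw [hTg]
      by_cases hp : i = j ∧ m = n
      · obtain ⟨rfl, rfl⟩ := hp
        simp [hq_def, hm]
      · have hp' : (j, n) ≠ (i, m) := fun h => hp
          ⟨(congrArg Prod.fst h).symm, (congrArg Prod.snd h).symm⟩
        rw [if_neg hp', sub_zero]
        simp only [hq_def]
        by_cases hn : n ∈ A j
        · rw [Set.indicator_of_mem hn, Set.indicator_of_mem (Set.mem_sdiff_of_mem hn hp)]
        · rw [Set.indicator_of_notMem hn, Set.indicator_of_notMem fun h => hn h.1]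
    rw [← hq.tsum_eq]
    exact (norm_tsum_le_tsum_norm h1).trans h2
  refine ⟨x, fun U hU hUne => ?_⟩
  obtain ⟨u, hu⟩ := hUne
  obtain ⟨ε, hε, hball⟩ := Metric.isOpen_iff.1 hU u hu
  obtain ⟨a, ha⟩ := Metric.denseRange_iff.1 hd u (ε / 2) (by positivity)
  obtain ⟨b, hb⟩ := exists_pow_lt_of_lt_one (show 0 < ε / 4 by positivity)
    (show (1 / 2 : ℝ) < 1 by norm_num)
  refine (hAd (Nat.pair a b)).trans_le (lowerDensity_mono fun m hm => hball ?_)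
  have h1 := hclose _ m hm
  have h2 : ((1 : ℝ) / 2) ^ Nat.pair a b ≤ (1 / 2) ^ b :=
    pow_le_pow_of_le_one (by norm_num) (by norm_num) (Nat.right_le_pair a b)
  have h3 : z (Nat.pair a b) 0 = y a 0 := by simp [hz_def]
  rw [h3] at h1
  rw [Metric.mem_ball, dist_eq_norm]
  rw [dist_comm, dist_eq_norm] at ha
  calc ‖(T ^ m) x - u‖ ≤ ‖(T ^ m) x - y a 0‖ + ‖y a 0 - u‖ := norm_sub_le_norm_sub_add_norm_sub ..
    _ < ε := by linarith

end Criterion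

/-! ### Holomorphic functions along complex lines -/

section Lines

variable {E : Type*} [NormedAddCommGroup E] [NormedSpace ℂ E]

/-- The parameters `t` for which the point `q + t (w - q)` of the complex line through `q` and `w`
lies in the ball of radius `R` around `c`. -/
def lineDomain (c : E) (R : ℝ) (q w : E) : Set ℂ :=
  {t : ℂ | q + t • (w - q) ∈ Metric.ball c R}

theorem isOpen_lineDomain (c : E) (R : ℝ) (q w : E) : IsOpen (lineDomain c R q w) :=
  Metric.isOpen_ball.preimage (by fun_prop)

theorem isPreconnected_lineDomain (c : E) (R : ℝ) (q w : E) :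
    IsPreconnected (lineDomain c R q w) := by
  refine Convex.isPreconnected fun t ht s hs a b ha hb hab => ?_
  have h := convex_ball c R ht hs ha hb hab
  have h1 : q + (a • t + b • s) • (w - q) =
      a • (q + t • (w - q)) + b • (q + s • (w - q)) := by
    have h2 : q = a • q + b • q := by rw [← add_smul, hab, one_smul]
    rw [add_smul, smul_assoc, smul_assoc, smul_add, smul_add]
    nth_rewrite 1 [h2]
    abel
  change q + (a • t + b • s) • (w - q) ∈ Metric.ball c R
  rwa [h1]

theorem differentiableOn_line {F : E → ℂ} {c : E} {R : ℝ}
    (hF : DifferentiableOn ℂ F (Metric.ball c R)) (q w : E) :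
    DifferentiableOn ℂ (fun t : ℂ => F (q + t • (w - q))) (lineDomain c R q w) :=
  hF.comp (f := fun t : ℂ => q + t • (w - q)) (by fun_prop) fun _ ht => ht

theorem eq_zero_of_frequently_eq_zero_on_line {F : E → ℂ} {c : E} {R : ℝ}
    (hF : DifferentiableOn ℂ F (Metric.ball c R)) {q w : E} (hw : w ∈ Metric.ball c R) {t₀ : ℂ}
    (ht₀ : t₀ ∈ lineDomain c R q w) (h : ∃ᶠ t in 𝓝[≠] t₀, F (q + t • (w - q)) = 0) :
    F w = 0 := by
  have h1 : (1 : ℂ) ∈ lineDomain c R q w := by simpa [lineDomain] using hw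
  have h2 := ((differentiableOn_line hF q w).analyticOnNhd
    (isOpen_lineDomain c R q w)).eqOn_zero_of_preconnected_of_frequently_eq_zero
    (isPreconnected_lineDomain c R q w) ht₀ h h1
  simpa using h2

/-- The identity theorem on a connected open set in several (or infinitely many) variables. -/
theorem eqOn_zero_of_eventually_eq_zero {Ω : Set E} (hΩ : IsOpen Ω) (hconn : IsPreconnected Ω)
    {F : E → ℂ} (hF : DifferentiableOn ℂ F Ω) {p : E} (hp : p ∈ Ω) (h : ∀ᶠ z in 𝓝 p, F z = 0) :
    ∀ z ∈ Ω, F z = 0 := by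
  have hsub : Ω ⊆ {z | ∀ᶠ x in 𝓝 z, F x = 0} := by
    refine hconn.subset_of_closure_inter_subset isOpen_setOfPred_eventually_nhds ⟨p, hp, h⟩ ?_
    rintro z ⟨hz, hzΩ⟩
    obtain ⟨R, hR, hball⟩ := Metric.isOpen_iff.1 hΩ z hzΩ
    obtain ⟨q, hq, hqz⟩ := Metric.mem_closure_iff.1 hz R hR
    have hqB : q ∈ Metric.ball z R := by rwa [Metric.mem_ball, dist_comm]
    filter_upwards [Metric.ball_mem_nhds z hR] with w hw
    refine eq_zero_of_frequently_eq_zero_on_line (hF.mono hball) (q := q) hw (t₀ := 0)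
      (by simpa [lineDomain] using hqB) ?_
    have h3 : Tendsto (fun t : ℂ => q + t • (w - q)) (𝓝 0) (𝓝 q) := by
      have : Continuous fun t : ℂ => q + t • (w - q) := by fun_prop
      simpa using this.tendsto 0
    exact ((h3.eventually hq).filter_mono nhdsWithin_le_nhds).frequently
  exact fun z hz => (hsub hz).self_of_nhds

end Lines

/-! ### Charts in which a holomorphic function is the exponential -/

theorem eventually_exp_ofReal_mul_I_ne (θ₀ : ℝ) (c : ℂ) :
    ∀ᶠ θ : ℝ in 𝓝[≠] θ₀, Complex.exp (θ * Complex.I) ≠ c := by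
  have h1 : HasDerivAt (fun θ : ℝ => Complex.exp (θ * Complex.I))
      (Complex.exp (θ₀ * Complex.I) * (1 * Complex.I)) θ₀ :=
    (((hasDerivAt_id _).mul_const Complex.I).cexp).comp_ofReal
  exact h1.eventually_ne (by simp)

/-- A holomorphic function of one variable which is not constant and has a unimodular value also
has a unimodular value at a regular point: critical points are isolated, and the function is
open. -/
theorem exists_unimodular_regular_point {D : Set ℂ} (hD : IsOpen D) (hconn : IsPreconnected D)
    {h : ℂ → ℂ} (hh : DifferentiableOn ℂ h D) {t₁ t₂ : ℂ} (ht₁ : t₁ ∈ D) (ht₂ : t₂ ∈ D)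
    (hne : h t₂ ≠ h t₁) (hnorm : ‖h t₁‖ = 1) : ∃ t ∈ D, ‖h t‖ = 1 ∧ deriv h t ≠ 0 := by
  have hana := hh.analyticOnNhd hD
  have hderiv : ¬ ∀ᶠ t in 𝓝 t₁, deriv h t = 0 := fun h0 =>
    hne (hD.is_const_of_deriv_eq_zero hconn hh
      (hana.deriv.eqOn_zero_of_preconnected_of_eventuallyEq_zero hconn ht₁ h0) ht₂ ht₁)
  have hpunct : ∀ᶠ t in 𝓝[≠] t₁, deriv h t ≠ 0 :=
    (hana.deriv t₁ ht₁).eventually_eq_zero_or_eventually_ne_zero.resolve_left hderiv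
  have hopen : 𝓝 (h t₁) ≤ map h (𝓝 t₁) := by
    refine (hana t₁ ht₁).eventually_constant_or_nhds_le_map_nhds.resolve_left fun h0 => hderiv ?_
    have h1 : h =ᶠ[𝓝 t₁] fun _ => h t₁ := h0
    filter_upwards [h1.deriv] with t ht
    rw [ht, deriv_const]
  have hmem : h '' {t | t ∈ D ∧ (t ≠ t₁ → deriv h t ≠ 0)} ∈ 𝓝 (h t₁) := by
    refine hopen (image_mem_map ?_)
    filter_upwards [hD.mem_nhds ht₁, eventually_nhdsWithin_iff.1 hpunct] with t h1 h2
    exact ⟨h1, h2⟩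
  obtain ⟨θ₀, hθ₀⟩ := (Complex.norm_eq_one_iff _).1 hnorm
  have hcont : Tendsto (fun θ : ℝ => Complex.exp (θ * Complex.I)) (𝓝[≠] θ₀) (𝓝 (h t₁)) := by
    have : Continuous fun θ : ℝ => Complex.exp (θ * Complex.I) := by fun_prop
    exact hθ₀ ▸ (this.tendsto θ₀).mono_left nhdsWithin_le_nhds
  obtain ⟨θ, ⟨t, ⟨htD, ht⟩, hθ⟩, hθne⟩ :=
    ((hcont.eventually_mem hmem).and (eventually_exp_ofReal_mul_I_ne θ₀ (h t₁))).exists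
  refine ⟨t, htD, ?_, ht ?_⟩
  · rw [hθ, Complex.norm_exp_ofReal_mul_I]
  · rintro rfl
    exact hθne hθ.symm

/-- Near a regular point with unimodular value, a logarithm of `h` is a coordinate. -/
theorem exists_local_log_coordinate {D : Set ℂ} {h : ℂ → ℂ} {t₀ : ℂ} (hD : D ∈ 𝓝 t₀)
    (hh : AnalyticAt ℂ h t₀) (hnorm : ‖h t₀‖ = 1) (hderiv : deriv h t₀ ≠ 0) :
    ∃ (θ₀ r : ℝ) (τ : ℂ → ℂ), 0 < r ∧ τ θ₀ = t₀ ∧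
      DifferentiableOn ℂ τ (Metric.ball (θ₀ : ℂ) r) ∧ Set.MapsTo τ (Metric.ball (θ₀ : ℂ) r) D ∧
      ∀ ζ ∈ Metric.ball (θ₀ : ℂ) r, h (τ ζ) = Complex.exp (ζ * Complex.I) := by
  obtain ⟨θ₀, hθ₀⟩ := (Complex.norm_eq_one_iff _).1 hnorm
  set g := hh.hasStrictDerivAt.localInverse _ _ _ hderiv with hg_def
  have hg : AnalyticAt ℂ g (h t₀) := hh.analyticAt_localInverse hderiv
  have hg0 : g (h t₀) = t₀ := HasStrictFDerivAt.localInverse_apply_image ..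
  have hgr : ∀ᶠ y in 𝓝 (h t₀), h (g y) = y :=
    hh.hasStrictDerivAt.eventually_right_inverse hderiv
  have hexp : AnalyticAt ℂ (fun ζ : ℂ => Complex.exp (ζ * Complex.I)) (θ₀ : ℂ) := by fun_prop
  have hτ : AnalyticAt ℂ (fun ζ : ℂ => g (Complex.exp (ζ * Complex.I))) (θ₀ : ℂ) :=
    AnalyticAt.fun_comp (g := g) (by rwa [hθ₀]) hexp
  have hτ0 : g (Complex.exp (θ₀ * Complex.I)) = t₀ := by rw [hθ₀, hg0]
  have h1 : ∀ᶠ ζ in 𝓝 (θ₀ : ℂ), h (g (Complex.exp (ζ * Complex.I))) =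
      Complex.exp (ζ * Complex.I) := by
    have h2 := hexp.continuousAt.tendsto
    rw [hθ₀] at h2
    exact h2.eventually hgr
  have h3 : ∀ᶠ ζ in 𝓝 (θ₀ : ℂ), g (Complex.exp (ζ * Complex.I)) ∈ D := by
    have h4 := hτ.continuousAt.tendsto
    rw [hτ0] at h4
    exact h4.eventually_mem hD
  obtain ⟨r, hr, hball⟩ := Metric.eventually_nhds_iff_ball.1
    (h1.and (h3.and hτ.eventually_analyticAt))
  exact ⟨θ₀, r, fun ζ => g (Complex.exp (ζ * Complex.I)), hr, hτ0,
    fun ζ hζ => (hball ζ hζ).2.2.differentiableAt.differentiableWithinAt,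
    fun ζ hζ => (hball ζ hζ).2.1, fun ζ hζ => (hball ζ hζ).1⟩

section Charts

variable {E : Type*} [NormedAddCommGroup E] [NormedSpace ℂ E]

/-- A holomorphic disc `γ` in `Ω`, parametrized by a disc around the real number `θ₀`, along which
`Φ` is `ζ ↦ exp (i ζ)`; the real parameters are those with unimodular values of `Φ`. -/
structure IsUnimodularChart (Ω : Set E) (Φ : E → ℂ) (γ : ℂ → E) (θ₀ r : ℝ) : Prop where
  pos : 0 < r
  differentiableOn : DifferentiableOn ℂ γ (Metric.ball (θ₀ : ℂ) r)
  mapsTo : Set.MapsTo γ (Metric.ball (θ₀ : ℂ) r) Ω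
  apply_eq : ∀ ζ ∈ Metric.ball (θ₀ : ℂ) r, Φ (γ ζ) = Complex.exp (ζ * Complex.I)

theorem ofReal_mem_ball {θ θ₀ r : ℝ} (h : θ ∈ Set.Ioo (θ₀ - r) (θ₀ + r)) :
    (θ : ℂ) ∈ Metric.ball (θ₀ : ℂ) r := by
  rw [Metric.mem_ball, Complex.dist_eq, ← Complex.ofReal_sub, Complex.norm_real, Real.norm_eq_abs,
    abs_lt]
  constructor <;> linarith [h.1, h.2]

/-- Unimodular charts are a set of uniqueness for holomorphic functions: through a point `p` with
`‖Φ p‖ = 1` and any `w` in a ball around `p` with `Φ w ≠ Φ p` there is a complex line, and this line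
carries a chart, since `Φ` is not constant on it. -/
theorem eq_zero_of_frequently_eq_zero_on_charts {Ω : Set E} (hΩ : IsOpen Ω)
    (hconn : IsPreconnected Ω) {Φ F : E → ℂ} (hΦ : DifferentiableOn ℂ Φ Ω)
    (hF : DifferentiableOn ℂ F Ω) (hΦne : ∃ z ∈ Ω, ∃ w ∈ Ω, Φ z ≠ Φ w)
    (hΦ1 : ∃ p ∈ Ω, ‖Φ p‖ = 1)
    (h : ∀ γ θ₀ r, IsUnimodularChart Ω Φ γ θ₀ r → ∃ᶠ θ : ℝ in 𝓝[≠] θ₀, F (γ θ) = 0) :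
    ∀ z ∈ Ω, F z = 0 := by
  obtain ⟨p, hp, hp1⟩ := hΦ1
  obtain ⟨R, hR, hball⟩ := Metric.isOpen_iff.1 hΩ p hp
  have hpB : p ∈ Metric.ball p R := Metric.mem_ball_self hR
  have key : ∀ w ∈ Metric.ball p R, Φ w ≠ Φ p → F w = 0 := by
    intro w hw hne
    have hdiff := differentiableOn_line (hΦ.mono hball) p w
    have hopen := isOpen_lineDomain p R p w
    obtain ⟨t₀, ht₀, hnorm, hderiv⟩ := exists_unimodular_regular_point hopen
      (isPreconnected_lineDomain p R p w) hdiff (t₁ := 0) (t₂ := 1)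
      (by simpa [lineDomain] using hR) (by simpa [lineDomain, dist_eq_norm] using hw)
      (by simpa using hne)
      (by simpa using hp1)
    obtain ⟨θ₀, r, τ, hr, hτ0, hτd, hτD, hτ⟩ := exists_local_log_coordinate
      (hopen.mem_nhds ht₀) (hdiff.analyticOnNhd hopen t₀ ht₀) hnorm hderiv
    have hchart : IsUnimodularChart Ω Φ (fun ζ => p + τ ζ • (w - p)) θ₀ r :=
      ⟨hr, (hτd.smul_const _).const_add p, fun ζ hζ => hball (hτD hζ), hτ⟩
    have hθ₀ : (θ₀ : ℂ) ∈ Metric.ball (θ₀ : ℂ) r := Metric.mem_ball_self hr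
    have htend : Tendsto (fun θ : ℝ => τ θ) (𝓝[≠] θ₀) (𝓝[≠] t₀) := by
      have hcont : ContinuousAt (fun θ : ℝ => τ θ) θ₀ :=
        ContinuousAt.comp (f := ((↑) : ℝ → ℂ)) (g := τ)
          (hτd.continuousOn.continuousAt (Metric.isOpen_ball.mem_nhds hθ₀))
          Complex.continuous_ofReal.continuousAt
      refine tendsto_nhdsWithin_iff.2 ⟨?_, ?_⟩
      · have := hcont.tendsto
        rw [hτ0] at this
        exact this.mono_left nhdsWithin_le_nhds
      · filter_upwards [eventually_exp_ofReal_mul_I_ne θ₀ (Complex.exp (θ₀ * Complex.I)),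
          nhdsWithin_le_nhds (Ioo_mem_nhds (show θ₀ - r < θ₀ by linarith)
            (show θ₀ < θ₀ + r by linarith))] with θ h1 h2 heq
        refine h1 ?_
        rw [← hτ θ (ofReal_mem_ball h2), ← hτ θ₀ hθ₀, hτ0, heq]
    exact eq_zero_of_frequently_eq_zero_on_line (hF.mono hball) hw ht₀
      (htend.frequently (h _ _ _ hchart))
  obtain ⟨w, hw, hne⟩ : ∃ w ∈ Metric.ball p R, Φ w ≠ Φ p := by
    by_contra! hcon
    have h1 : ∀ z ∈ Ω, Φ z - Φ p = 0 :=
      eqOn_zero_of_eventually_eq_zero hΩ hconn (hΦ.sub_const _) hp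
        (by filter_upwards [Metric.ball_mem_nhds p hR] with z hz using sub_eq_zero.2 (hcon z hz))
    obtain ⟨z, hz, w, hw, hzw⟩ := hΦne
    exact hzw (by rw [sub_eq_zero.1 (h1 z hz), sub_eq_zero.1 (h1 w hw)])
  refine eqOn_zero_of_eventually_eq_zero hΩ hconn hF (hball hw) ?_
  filter_upwards [Metric.isOpen_ball.mem_nhds hw,
    (hΦ.continuousOn.continuousAt (hΩ.mem_nhds (hball hw))).eventually_ne hne] with z h1 h2
  exact key z h1 h2

end Charts

/-! ### Oscillatory integrals -/

/-- Integrating by parts twice bounds the Fourier coefficients of a holomorphic function with double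
zeros at the end points. -/
theorem exists_bound_oscillatory_integral {U : Set ℂ} (hU : IsOpen U) {g : ℂ → ℂ}
    (hg : DifferentiableOn ℂ g U) {a b : ℝ} (hab : ∀ θ ∈ Set.uIcc a b, (θ : ℂ) ∈ U)
    (ha : g a = 0) (hb : g b = 0) (ha' : deriv g a = 0) (hb' : deriv g b = 0) :
    ∃ C, ∀ k : ℤ, ‖(k : ℂ) ^ 2 * ∫ θ in a..b, Complex.exp (θ * Complex.I) ^ k * g θ‖ ≤ C := by
  have hg1 := hg.deriv hU
  have hg2 := hg1.deriv hU
  have hcont : ∀ {u : ℂ → ℂ}, DifferentiableOn ℂ u U →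
      ContinuousOn (fun θ : ℝ => u θ) (Set.uIcc a b) := fun hu =>
    hu.continuousOn.comp Complex.continuous_ofReal.continuousOn hab
  have hexp : ∀ k : ℤ, Continuous fun θ : ℝ => Complex.exp (θ * Complex.I) ^ k := fun k =>
    Continuous.zpow₀ (by fun_prop) k fun θ => Or.inl (Complex.exp_ne_zero _)
  have hnorm : ∀ (k : ℤ) (θ : ℝ), ‖Complex.exp (θ * Complex.I) ^ k‖ = 1 := fun k θ => by
    rw [norm_zpow, Complex.norm_exp_ofReal_mul_I, one_zpow]
  obtain ⟨M, hM⟩ := isCompact_uIcc.exists_bound_of_continuousOn (hcont hg2)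
  refine ⟨M * |b - a|, fun k => ?_⟩
  have hint1 : IntervalIntegrable (fun θ : ℝ => Complex.exp (θ * Complex.I) ^ k * g θ)
      MeasureTheory.volume a b := ((hexp k).continuousOn.mul (hcont hg)).intervalIntegrable
  have hint2 : IntervalIntegrable (fun θ : ℝ => Complex.exp (θ * Complex.I) ^ k *
      deriv (deriv g) θ) MeasureTheory.volume a b :=
    ((hexp k).continuousOn.mul (hcont hg2)).intervalIntegrable
  have hFTC : ∫ θ in a..b, ((k : ℂ) ^ 2 * (Complex.exp (θ * Complex.I) ^ k * g θ) +
      Complex.exp (θ * Complex.I) ^ k * deriv (deriv g) θ) = 0 := by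
    rw [intervalIntegral.integral_eq_sub_of_hasDerivAt
      (f := fun θ : ℝ => Complex.exp (k * (θ * Complex.I)) *
        (-(k * Complex.I) * g θ + deriv g θ)) _
      ((hint1.const_mul _).add hint2)]
    · simp [ha, hb, ha', hb']
    · intro θ hθ
      have hθU := hU.mem_nhds (hab θ hθ)
      have h1 : HasDerivAt (fun ζ : ℂ => Complex.exp (k * (ζ * Complex.I)))
          (Complex.exp (k * (θ * Complex.I)) * (k * (1 * Complex.I))) (θ : ℂ) :=
        (((hasDerivAt_id _).mul_const Complex.I).const_mul (k : ℂ)).cexp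
      have h2 : HasDerivAt g (deriv g θ) (θ : ℂ) := (hg.differentiableAt hθU).hasDerivAt
      have h3 : HasDerivAt (deriv g) (deriv (deriv g) θ) (θ : ℂ) :=
        (hg1.differentiableAt hθU).hasDerivAt
      have h4 := (h1.mul ((h2.const_mul (-(k * Complex.I))).add h3)).comp_ofReal
      refine h4.congr_deriv ?_
      simp only [Pi.add_apply]
      rw [← Complex.exp_int_mul]
      linear_combination (-(k : ℂ) ^ 2 * Complex.exp (k * (θ * Complex.I)) * g θ) *
        Complex.I_sq
  have hsplit : (k : ℂ) ^ 2 * ∫ θ in a..b, Complex.exp (θ * Complex.I) ^ k * g θ =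
      -∫ θ in a..b, Complex.exp (θ * Complex.I) ^ k * deriv (deriv g) θ := by
    rw [intervalIntegral.integral_add (hint1.const_mul _) hint2,
      intervalIntegral.integral_const_mul] at hFTC
    exact eq_neg_of_add_eq_zero_left hFTC
  rw [hsplit, norm_neg]
  refine intervalIntegral.norm_integral_le_of_norm_le_const fun θ hθ => ?_
  rw [norm_mul, hnorm, one_mul]
  exact hM θ (Set.uIoc_subset_uIcc hθ)

/-- A continuous function whose weighted integrals over all subintervals vanish is zero. -/
theorem eq_zero_of_forall_weighted_integral_eq_zero {α β : ℝ} {u : ℝ → ℂ}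
    (hu : ContinuousOn u (Set.Ioo α β))
    (h : ∀ a b, α < a → a < b → b < β →
      ∫ θ in a..b, (((θ - a) ^ 2 * (θ - b) ^ 2 : ℝ) : ℂ) * u θ = 0) :
    ∀ θ ∈ Set.Ioo α β, u θ = 0 := by
  intro θ₁ hθ₁
  by_contra hne
  -- After a rotation, `u` has positive real part near `θ₁`.
  set v : ℝ → ℝ := fun θ => (starRingEnd ℂ (u θ₁) * u θ).re with hv_def
  have hv : ContinuousOn v (Set.Ioo α β) :=
    Complex.continuous_re.comp_continuousOn (continuousOn_const.mul hu)
  have hv1 : 0 < v θ₁ := by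
    simp only [hv_def, ← Complex.normSq_eq_conj_mul_self, Complex.ofReal_re]
    exact Complex.normSq_pos.2 hne
  obtain ⟨δ, hδ, hball⟩ := Metric.eventually_nhds_iff_ball.1
    (((hv.continuousAt (Ioo_mem_nhds hθ₁.1 hθ₁.2)).eventually (lt_mem_nhds hv1)).and
      (Ioo_mem_nhds hθ₁.1 hθ₁.2))
  have hmem : ∀ θ ∈ Set.Icc (θ₁ - δ / 2) (θ₁ + δ / 2), 0 < v θ ∧ θ ∈ Set.Ioo α β := by
    intro θ hθ
    refine hball θ ?_
    rw [Metric.mem_ball, Real.dist_eq, abs_lt]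
    constructor <;> linarith [hθ.1, hθ.2]
  have hlt : θ₁ - δ / 2 < θ₁ + δ / 2 := by linarith
  set a := θ₁ - δ / 2
  set b := θ₁ + δ / 2
  have huab : ContinuousOn u (Set.uIcc a b) := by
    rw [Set.uIcc_of_le hlt.le]
    exact hu.mono fun θ hθ => (hmem θ hθ).2
  have hvab : ContinuousOn v (Set.uIcc a b) :=
    Complex.continuous_re.comp_continuousOn (continuousOn_const.mul huab)
  have hint : IntervalIntegrable (fun θ : ℝ => (((θ - a) ^ 2 * (θ - b) ^ 2 : ℝ) : ℂ) * u θ)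
      MeasureTheory.volume a b := by
    refine (ContinuousOn.mul ?_ huab).intervalIntegrable
    exact (by fun_prop : Continuous fun θ : ℝ =>
      (((θ - a) ^ 2 * (θ - b) ^ 2 : ℝ) : ℂ)).continuousOn
  have hpos : 0 < ∫ θ in a..b, (θ - a) ^ 2 * (θ - b) ^ 2 * v θ := by
    refine intervalIntegral.intervalIntegral_pos_of_pos_on ?_ (fun θ hθ => ?_) hlt
    · exact (ContinuousOn.mul (by fun_prop) hvab).intervalIntegrable
    · have h1 : 0 < θ - a := sub_pos.2 hθ.1
      have h2 : θ - b ≠ 0 := (sub_neg.2 hθ.2).ne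
      have h3 := (hmem θ ⟨hθ.1.le, hθ.2.le⟩).1
      positivity
  have hzero : ∫ θ in a..b, (θ - a) ^ 2 * (θ - b) ^ 2 * v θ = 0 := by
    have h1 := h a b (hmem a ⟨le_rfl, hlt.le⟩).2.1 hlt (hmem b ⟨hlt.le, le_rfl⟩).2.2
    have h2 := Complex.reCLM.intervalIntegral_comp_comm (hint.const_mul (starRingEnd ℂ (u θ₁)))
    rw [intervalIntegral.integral_const_mul, h1, mul_zero, map_zero] at h2
    rw [← h2]
    refine intervalIntegral.integral_congr fun θ _ => ?_
    simp only [hv_def, Complex.reCLM_apply]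
    rw [mul_left_comm, Complex.re_ofReal_mul]
  exact hpos.ne' hzero

/-! ### Relations between the dynamical properties -/

section Dynamics

variable {X : Type*} [NormedAddCommGroup X] [NormedSpace ℂ X] {T : X →L[ℂ] X}

theorem FrequentlyHypercyclic.hypercyclic (h : FrequentlyHypercyclic T) : Hypercyclic T := by
  obtain ⟨x, hx⟩ := h
  refine ⟨x, dense_iff_inter_open.2 fun U hU hne => ?_⟩
  obtain ⟨n, hn⟩ := (infinite_of_upperDensity_pos
    ((hx U hU hne).trans_le (lowerDensity_le_upperDensity _))).nonempty
  exact ⟨_, hn, n, rfl⟩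

theorem Hypercyclic.recurrent [Nontrivial X] (h : Hypercyclic T) : Recurrent T := by
  classical
  obtain ⟨x, hx⟩ := h
  have : ∀ y : X, NeBot (𝓝[≠] y) := fun y => Module.punctured_nhds_neBot ℂ X y
  intro U hU hne
  obtain ⟨_, hn, n, rfl⟩ := hx.inter_open_nonempty U hU hne
  -- The orbit stays dense after removal of its first points.
  obtain ⟨_, hm, ⟨m, rfl⟩, hm'⟩ := (hx.sdiff_finset
    ((Finset.range (n + 1)).image fun i => (T ^ i) x)).inter_open_nonempty U hU hne
  have hnm : n < m := by
    by_contra! hle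
    exact hm' (Finset.mem_coe.2 (Finset.mem_image.2 ⟨m, Finset.mem_range.2 (by omega), rfl⟩))
  refine ⟨m - n, by omega, (T ^ n) x, hn, ?_⟩
  rw [Set.mem_preimage, ← mul_apply_eq_comp, ← pow_add, Nat.sub_add_cancel hnm.le]
  exact hm

theorem HasPropertyA.recurrent (h : HasPropertyA T) : Recurrent T := by
  intro U hU hne
  obtain ⟨x, hx⟩ := h U hU hne
  have hinf := infinite_of_upperDensity_pos hx
  obtain ⟨n, hn⟩ := hinf.nonempty
  obtain ⟨m, hm, hnm⟩ := hinf.exists_gt n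
  refine ⟨m - n, by omega, (T ^ n) x, hn, ?_⟩
  rw [Set.mem_preimage, ← mul_apply_eq_comp, ← pow_add, Nat.sub_add_cancel hnm.le]
  exact hm

theorem TopologicallyMultiplyRecurrent.recurrent (h : TopologicallyMultiplyRecurrent T) :
    Recurrent T := by
  intro U hU hne
  obtain ⟨k, hk, x, hxU, hx⟩ := h U hU hne 1 one_pos
  exact ⟨k, hk, x, hxU, by simpa using Set.mem_iInter₂.1 hx 1 (by simp)⟩

theorem pow_mul_apply_eq_self {x : X} {p : ℕ} (h : (T ^ p) x = x) (m : ℕ) :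
    (T ^ (m * p)) x = x := by
  induction m with
  | zero => simp
  | succ m ih => rw [add_mul, one_mul, pow_add, mul_apply_eq_comp, h, ih]

theorem topologicallyMultiplyRecurrent_of_dense_periodic
    (h : Dense {x : X | ∃ p, 0 < p ∧ (T ^ p) x = x}) : TopologicallyMultiplyRecurrent T := by
  intro U hU hne m _
  obtain ⟨x, hxU, p, hp, hx⟩ := h.inter_open_nonempty U hU hne
  refine ⟨p, hp, x, hxU, Set.mem_iInter₂.2 fun j _ => ?_⟩
  rw [Set.mem_preimage, pow_mul_apply_eq_self hx]
  exact hxU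

theorem hasPropertyA_of_dense_periodic
    (h : Dense {x : X | ∃ p, 0 < p ∧ (T ^ p) x = x}) : HasPropertyA T := by
  intro U hU hne
  obtain ⟨x, hxU, p, hp, hx⟩ := h.inter_open_nonempty U hU hne
  refine ⟨x, (lowerDensity_pos_of_linear_growth (u := fun m => (m + 1) * p) (fun a b hab => ?_)
    (fun m => ?_) (fun m => by positivity) hp (fun m => (mul_comm _ _).le)).trans_le
    (lowerDensity_le_upperDensity _)⟩
  · have := Nat.eq_of_mul_eq_mul_right hp hab
    omega
  · rw [Set.mem_ofPred_eq, pow_mul_apply_eq_self hx]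
    exact hxU

theorem Recurrent.of_leftInverse {S : X →L[ℂ] X} (hST : S * T = 1) (h : Recurrent T) :
    Recurrent S := by
  intro U hU hne
  obtain ⟨k, hk, x, hxU, hx⟩ := h U hU hne
  refine ⟨k, hk, (T ^ k) x, hx, ?_⟩
  have h1 : S ^ k * T ^ k = 1 := by
    clear hx hk
    induction k with
    | zero => simp
    | succ k ih => rw [pow_succ, pow_succ', mul_assoc, ← mul_assoc S, hST, one_mul, ih]
  rw [Set.mem_preimage, ← mul_apply_eq_comp, h1]
  exact hxU

theorem pow_apply_of_apply_eq_smul {e : X} {c : ℂ} (h : T e = c • e) (k : ℕ) :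
    (T ^ k) e = c ^ k • e := by
  induction k with
  | zero => simp
  | succ k ih => rw [pow_succ, mul_apply_eq_comp, h, map_smul, ih, smul_smul, pow_succ']

/-- If `e` were an eigenvector for such an eigenvalue `c`, then the contractions `T ^ k` would
move a small ball around `e` away from itself, as they move `e` by at least
`(1 - ‖c‖) * ‖e‖`. -/
theorem Recurrent.not_contraction_of_eigenvector (h : Recurrent T) (hT : ‖T‖ ≤ 1) {e : X}
    (he : e ≠ 0) {c : ℂ} (hc : ‖c‖ < 1) : T e ≠ c • e := by
  intro hTe
  have he' : 0 < ‖e‖ := norm_pos_iff.2 he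
  set δ := (1 - ‖c‖) * ‖e‖ / 2 with hδ
  have hδpos : 0 < δ := div_pos (mul_pos (sub_pos.2 hc) he') two_pos
  obtain ⟨k, hk, x, hx, hkx⟩ := h (Metric.ball e δ) Metric.isOpen_ball
    ⟨e, Metric.mem_ball_self hδpos⟩
  rw [Metric.mem_ball, dist_eq_norm] at hx
  rw [Set.mem_preimage, Metric.mem_ball, dist_eq_norm] at hkx
  have h1 : ‖(T ^ k) (x - e)‖ ≤ ‖x - e‖ := by
    calc ‖(T ^ k) (x - e)‖ ≤ ‖T ^ k‖ * ‖x - e‖ := ContinuousLinearMap.le_opNorm _ _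
      _ ≤ 1 * ‖x - e‖ := by
          gcongr
          exact (norm_pow_le' T hk).trans (pow_le_one₀ (norm_nonneg _) hT)
      _ = ‖x - e‖ := one_mul _
  have h2 : (1 - c ^ k) • e = (T ^ k) (x - e) - ((T ^ k) x - e) := by
    rw [map_sub, pow_apply_of_apply_eq_smul hTe, sub_smul, one_smul]
    abel
  have h3 : 1 - ‖c‖ ≤ ‖1 - c ^ k‖ := by
    have h4 : ‖c ^ k‖ ≤ ‖c‖ := by
      rw [norm_pow]
      exact pow_le_of_le_one (norm_nonneg _) hc.le hk.ne'
    have h5 := norm_sub_norm_le (1 : ℂ) (c ^ k)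
    rw [norm_one] at h5
    linarith
  have h6 : (1 - ‖c‖) * ‖e‖ ≤ ‖(1 - c ^ k) • e‖ := by
    rw [norm_smul]
    gcongr
  have h7 := norm_sub_le ((T ^ k) (x - e)) ((T ^ k) x - e)
  rw [← h2] at h7
  linarith

/-- The vectors `x` through which there is a two-sided orbit `y : ℤ → X` of `T`, with `y 0 = x`,
whose norms are summable. No uniqueness of the backward orbit is asked for. -/
def summableOrbits (T : X →L[ℂ] X) : Submodule ℂ X where
  carrier := {x | ∃ y : ℤ → X, y 0 = x ∧ (∀ k, T (y k) = y (k + 1)) ∧ Summable fun k => ‖y k‖}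
  add_mem' := by
    rintro _ _ ⟨y, rfl, hy, hys⟩ ⟨z, rfl, hz, hzs⟩
    refine ⟨fun k => y k + z k, rfl, fun k => by rw [map_add, hy, hz], ?_⟩
    exact Summable.of_nonneg_of_le (fun _ => norm_nonneg _) (fun _ => norm_add_le _ _)
      (hys.add hzs)
  zero_mem' := ⟨fun _ => 0, rfl, fun _ => map_zero T, by simp⟩
  smul_mem' := by
    rintro c _ ⟨y, rfl, hy, hys⟩
    exact ⟨fun k => c • y k, rfl, fun k => by rw [map_smul, hy], by
      simpa only [norm_smul] using hys.mul_left ‖c‖⟩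

theorem frequentlyHypercyclic_of_dense_summableOrbits [CompleteSpace X]
    [TopologicalSpace.SeparableSpace X] (h : Dense (summableOrbits T : Set X)) :
    FrequentlyHypercyclic T := by
  have : SecondCountableTopology X := UniformSpace.secondCountable_of_separable X
  obtain ⟨t, ht, htc, htd⟩ := h.exists_countable_dense_subset
  obtain ⟨x, rfl⟩ := htc.exists_eq_range htd.nonempty
  choose y hy0 hyT hys using fun j => ht ⟨j, rfl⟩
  refine frequentlyHypercyclic_of_summable_orbits T y hyT hys ?_
  simp only [hy0]
  exact htd

end Dynamics

/-! ### Adjoints of multiplication operators -/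

section Kernels

open RKHS

variable {S : Type*} (H : Type*) [NormedAddCommGroup H] [InnerProductSpace ℂ H] [CompleteSpace H]
  [RKHS ℂ H S ℂ]

/-- The reproducing kernel at `z`: the vector `k` with `⟪k, f⟫ = f z` for all `f`. -/
noncomputable def kernelAt (z : S) : H := kerFun H z (1 : ℂ)

variable {H}

theorem kernelAt_inner (z : S) (f : H) : inner ℂ (kernelAt H z) f = f z := by
  simp [kernelAt]

theorem dense_span_kernelAt {s : Set S} (h : ∀ f : H, (∀ z ∈ s, f z = 0) → f = 0) :
    Dense (Submodule.span ℂ (kernelAt H '' s) : Set H) := by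
  rw [Submodule.dense_iff_topologicalClosure_eq_top, Submodule.topologicalClosure_eq_top_iff,
    Submodule.eq_bot_iff]
  intro f hf
  refine h f fun z hz => ?_
  rw [← kernelAt_inner]
  exact (Submodule.mem_orthogonal _ _).1 hf _ (Submodule.subset_span ⟨z, hz, rfl⟩)

theorem adjoint_mulOp_kernelAt {φ : S → ℂ} (h : IsMultiplier H φ) (z : S) :
    ContinuousLinearMap.adjoint (mulOp φ h) (kernelAt H z) =
      (starRingEnd ℂ) (φ z) • kernelAt H z := by
  refine ext_inner_right ℂ fun f => ?_
  rw [ContinuousLinearMap.adjoint_inner_left, kernelAt_inner, mulOp_apply, inner_smul_left,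
    kernelAt_inner, starRingEnd_self_apply]

theorem exists_kernelAt_ne_zero [Nontrivial H] : ∃ z : S, kernelAt H z ≠ 0 := by
  by_contra! hcon
  obtain ⟨f, hf⟩ := exists_ne (0 : H)
  refine hf (RKHS.ext fun z => ?_)
  rw [← kernelAt_inner, hcon, inner_zero_left, RKHS.coe_zero, Pi.zero_apply]

theorem adjoint_mulOp_mul_adjoint_mulOp {φ ψ : S → ℂ} (hφ : IsMultiplier H φ)
    (hψ : IsMultiplier H ψ) (h : ∀ z, φ z * ψ z = 1) :
    ContinuousLinearMap.adjoint (mulOp ψ hψ) * ContinuousLinearMap.adjoint (mulOp φ hφ) = 1 := by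
  ext1 f
  refine ext_inner_right ℂ fun g => ?_
  rw [mul_apply_eq_comp, ContinuousLinearMap.adjoint_inner_left,
    ContinuousLinearMap.adjoint_inner_left, one_apply_eq_self]
  congr 1
  ext z
  rw [mulOp_apply, mulOp_apply, ← mul_assoc, h, one_mul]

theorem exists_pow_apply_eq_self_of_mem_span {φ : S → ℂ} (h : IsMultiplier H φ) {x : H}
    (hx : x ∈ Submodule.span ℂ (kernelAt H '' {z | ∃ p, 0 < p ∧ φ z ^ p = 1})) :
    ∃ p, 0 < p ∧ (ContinuousLinearMap.adjoint (mulOp φ h) ^ p) x = x := by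
  induction hx using Submodule.span_induction with
  | mem x hx =>
    obtain ⟨z, ⟨p, hp, hz⟩, rfl⟩ := hx
    refine ⟨p, hp, ?_⟩
    rw [pow_apply_of_apply_eq_smul (adjoint_mulOp_kernelAt h z), ← map_pow, hz, map_one, one_smul]
  | zero => exact ⟨1, one_pos, map_zero _⟩
  | add x y _ _ hx hy =>
    obtain ⟨p, hp, hx⟩ := hx
    obtain ⟨q, hq, hy⟩ := hy
    refine ⟨p * q, by positivity, ?_⟩
    rw [map_add, pow_mul_apply_eq_self hy, mul_comm p q, pow_mul_apply_eq_self hx]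
  | smul c x _ hx =>
    obtain ⟨p, hp, hx⟩ := hx
    exact ⟨p, hp, by rw [map_smul, hx]⟩

end Kernels

/-! ### Recurrence forces a unimodular value -/

section Recurrence

variable {n : ℕ} {Ω : Set (EuclideanSpace ℂ (Fin n))}

theorem IsHolomorphic.continuous {f : Ω → ℂ} (h : IsHolomorphic Ω f) : Continuous f := by
  obtain ⟨F, hF, hFf⟩ := h
  have h1 := hF.continuousOn.domRestrict
  have h2 : Ω.domRestrict F = f := funext hFf
  rwa [h2] at h1

theorem IsNonconstBddHolomorphic.inv {φ : Ω → ℂ} (h : IsNonconstBddHolomorphic Ω φ)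
    (hφ : ∀ z, 1 < ‖φ z‖) : IsNonconstBddHolomorphic Ω fun z => (φ z)⁻¹ := by
  obtain ⟨F, hF, hFf⟩ := h.holomorphic
  obtain ⟨z, w, hzw⟩ := h.nonconstant
  refine ⟨⟨fun z => (F z)⁻¹, hF.inv fun z hz => ?_, fun z => congrArg _ (hFf z)⟩, ⟨1, ?_⟩,
    z, w, fun h => hzw (inv_injective h)⟩
  · rw [hFf ⟨z, hz⟩]
    exact norm_pos_iff.1 (one_pos.trans (hφ _))
  · rintro _ ⟨z, rfl⟩
    simp only [norm_inv]
    exact inv_le_one_of_one_le₀ (hφ z).le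

variable {H : Type*} [NormedAddCommGroup H] [InnerProductSpace ℂ H] [CompleteSpace H]
  [RKHS ℂ H Ω ℂ]

theorem exists_unimodular_value_of_recurrent [Nontrivial H] (hΩ : IsConnected Ω)
    (hmul : ∀ ψ : Ω → ℂ, IsNonconstBddHolomorphic Ω ψ → IsMultiplier H ψ)
    (hnorm : ∀ (ψ : Ω → ℂ) (hψ : IsNonconstBddHolomorphic Ω ψ),
      ‖mulOp ψ (hmul ψ hψ)‖ = ⨆ z : Ω, ‖ψ z‖)
    {φ : Ω → ℂ} (hφ : IsNonconstBddHolomorphic Ω φ)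
    (hrec : Recurrent (ContinuousLinearMap.adjoint (mulOp φ (hmul φ hφ)))) :
    ∃ z, ‖φ z‖ = 1 := by
  have : ConnectedSpace Ω := isConnected_iff_connectedSpace.1 hΩ
  obtain ⟨z, hz⟩ := exists_kernelAt_ne_zero (S := Ω) (H := H)
  have hcontr : ∀ (ψ : Ω → ℂ) (hψ : IsNonconstBddHolomorphic Ω ψ), (∀ z, ‖ψ z‖ < 1) →
      ¬ Recurrent (ContinuousLinearMap.adjoint (mulOp ψ (hmul ψ hψ))) := by
    intro ψ hψ hlt hψrec
    refine hψrec.not_contraction_of_eigenvector ?_ hz (c := (starRingEnd ℂ) (ψ z))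
      (by simpa using hlt z) (adjoint_mulOp_kernelAt _ z)
    rw [LinearIsometryEquiv.norm_map, hnorm ψ hψ]
    exact ciSup_le fun z => (hlt z).le
  have hcont : Continuous fun z => ‖φ z‖ := hφ.holomorphic.continuous.norm
  by_contra! hcon
  by_cases hex : ∃ w, ‖φ w‖ < 1
  · obtain ⟨w, hw⟩ := hex
    refine hcontr φ hφ (fun u => ?_) hrec
    by_contra! hu
    obtain ⟨v, hv⟩ := mem_range_of_exists_le_of_exists_ge hcont ⟨w, hw.le⟩ ⟨u, hu⟩
    exact hcon v hv
  · push Not at hex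
    have hgt : ∀ w, 1 < ‖φ w‖ := fun w => lt_of_le_of_ne (hex w) (hcon w).symm
    refine hcontr _ (hφ.inv hgt) (fun w => ?_) (hrec.of_leftInverse
      (adjoint_mulOp_mul_adjoint_mulOp _ _ fun w => mul_inv_cancel₀ ?_))
    · rw [norm_inv]
      exact inv_lt_one_of_one_lt₀ (hgt w)
    · exact norm_pos_iff.1 (one_pos.trans (hgt w))

end Recurrence

/-! ### Density of the periodic vectors and of the summable orbits -/

/-- A family of functionals, pointwise continuous in the parameter, can be integrated. -/
theorem exists_integral_functional {X : Type*} [NormedAddCommGroup X] [NormedSpace ℂ X]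
    [CompleteSpace X] {a b : ℝ} (Λ : ℝ → X →L[ℂ] ℂ) (c : ℝ → ℂ)
    (hΛ : ∀ f, ContinuousOn (fun θ => Λ θ f) (Set.uIcc a b)) (hc : ContinuousOn c (Set.uIcc a b)) :
    ∃ L : X →L[ℂ] ℂ, ∀ f, L f = ∫ θ in a..b, c θ * Λ θ f := by
  obtain ⟨C, hC⟩ := banach_steinhaus (g := fun θ : Set.uIcc a b => Λ θ) fun f => by
    obtain ⟨M, hM⟩ := isCompact_uIcc.exists_bound_of_continuousOn (hΛ f)
    exact ⟨M, fun θ => hM θ θ.2⟩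
  obtain ⟨M, hM⟩ := isCompact_uIcc.exists_bound_of_continuousOn hc
  have hint : ∀ f, IntervalIntegrable (fun θ => c θ * Λ θ f) MeasureTheory.volume a b := fun f =>
    (hc.mul (hΛ f)).intervalIntegrable
  have hM0 : 0 ≤ M := (norm_nonneg _).trans (hM a Set.left_mem_uIcc)
  refine ⟨LinearMap.mkContinuous
    { toFun := fun f => ∫ θ in a..b, c θ * Λ θ f
      map_add' := fun f g => ?_
      map_smul' := fun s f => ?_ } (M * C * |b - a|) fun f => ?_, fun f => rfl⟩
  · simp only [map_add, mul_add]
    exact intervalIntegral.integral_add (hint f) (hint g)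
  · simp only [map_smul, smul_eq_mul, RingHom.id_apply]
    rw [← intervalIntegral.integral_const_mul]
    simp only [mul_left_comm]
  · refine (intervalIntegral.norm_integral_le_of_norm_le_const (C := M * (C * ‖f‖))
      fun θ hθ => ?_).trans_eq (by ring)
    have hθ' := Set.uIoc_subset_uIcc hθ
    rw [norm_mul]
    exact mul_le_mul (hM θ hθ') ((Λ θ).le_of_opNorm_le (hC ⟨θ, hθ'⟩) f) (norm_nonneg _) hM0

section Evaluation

variable {n : ℕ} {Ω : Set (EuclideanSpace ℂ (Fin n))} (H : Type*) [NormedAddCommGroup H]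
  [InnerProductSpace ℂ H] [RKHS ℂ H Ω ℂ]

open Classical in
/-- The evaluation functional at a point of `ℂⁿ`, taken to be `0` at the points outside `Ω`. -/
noncomputable def evalExt (z : EuclideanSpace ℂ (Fin n)) : H →L[ℂ] ℂ :=
  if h : z ∈ Ω then (ContinuousLinearMap.proj (⟨z, h⟩ : Ω)).comp (RKHS.coeCLM ℂ) else 0

variable {H}

theorem evalExt_apply (z : Ω) (f : H) : evalExt H (z : EuclideanSpace ℂ (Fin n)) f = f z := by
  simp [evalExt]

theorem evalExt_apply_of_mem {z : EuclideanSpace ℂ (Fin n)} (hz : z ∈ Ω) (f : H) :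
    evalExt H z f = f ⟨z, hz⟩ :=
  evalExt_apply ⟨z, hz⟩ f

theorem differentiableOn_evalExt {f : H} (hf : IsHolomorphic Ω fun z : Ω => f z) :
    DifferentiableOn ℂ (fun z => evalExt H z f) Ω := by
  obtain ⟨F, hF, hFf⟩ := hf
  exact hF.congr fun z hz => (evalExt_apply ⟨z, hz⟩ f).trans (hFf ⟨z, hz⟩).symm

variable (hΩ : IsOpen Ω) (hconn : IsPreconnected Ω)
  (hH : ∀ f : H, IsHolomorphic Ω (fun z : Ω => f z))
  {φ : Ω → ℂ} {Φ : EuclideanSpace ℂ (Fin n) → ℂ} (hΦ : DifferentiableOn ℂ Φ Ω)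
  (hΦφ : ∀ z : Ω, Φ z = φ z) (hne : ∃ z w : Ω, φ z ≠ φ w) (h1 : ∃ z, ‖φ z‖ = 1)

include hΩ hconn hH hΦ hΦφ hne h1

/-- An element of `H` vanishes if, on every unimodular chart, its zeros at real parameters accumulate
at the centre of the chart. -/
theorem eq_zero_of_frequently_evalExt_eq_zero (f : H)
    (h : ∀ γ θ₀ r, IsUnimodularChart Ω Φ γ θ₀ r →
      ∃ᶠ θ : ℝ in 𝓝[≠] θ₀, evalExt H (γ θ) f = 0) : f = 0 := by
  obtain ⟨z, w, hzw⟩ := hne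
  obtain ⟨p, hp⟩ := h1
  have h2 := eq_zero_of_frequently_eq_zero_on_charts hΩ hconn hΦ (differentiableOn_evalExt (hH f))
    ⟨z, z.2, w, w.2, by rwa [hΦφ, hΦφ]⟩ ⟨p, p.2, by rwa [hΦφ]⟩ h
  refine RKHS.ext fun z => ?_
  rw [← evalExt_apply, h2 z z.2, RKHS.coe_zero, Pi.zero_apply]

variable [CompleteSpace H]

theorem dense_periodic (hφ : IsMultiplier H φ) :
    Dense {x : H | ∃ p, 0 < p ∧ (ContinuousLinearMap.adjoint (mulOp φ hφ) ^ p) x = x} := by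
  refine (dense_span_kernelAt (H := H) (s := {z | ∃ p, 0 < p ∧ φ z ^ p = 1}) fun f hf => ?_).mono
    fun x hx => exists_pow_apply_eq_self_of_mem_span hφ hx
  refine eq_zero_of_frequently_evalExt_eq_zero hΩ hconn hH hΦ hΦφ hne h1 f
    fun γ θ₀ r hγ => ?_
  have hdense : DenseRange fun q : ℚ => 2 * Real.pi * (q : ℝ) :=
    (mul_left_surjective₀ Real.two_pi_pos.ne').denseRange.comp Rat.denseRange_cast (by fun_prop)
  rw [frequently_iff]
  intro U hU
  obtain ⟨V, hV, hθV, hVU⟩ := mem_nhdsWithin.1 (inter_mem hU (nhdsWithin_le_nhds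
    (Ioo_mem_nhds (show θ₀ - r < θ₀ by linarith [hγ.pos])
      (show θ₀ < θ₀ + r by linarith [hγ.pos]))))
  obtain ⟨_, hθ, q, rfl⟩ := hdense.inter_open_nonempty (V ∩ {θ₀}ᶜ)
    (hV.inter isOpen_compl_singleton)
    (Filter.nonempty_of_mem (f := 𝓝[≠] θ₀)
      (inter_mem (mem_nhdsWithin_of_mem_nhds (hV.mem_nhds hθV)) self_mem_nhdsWithin))
  refine ⟨_, (hVU hθ).1, ?_⟩
  have hball := ofReal_mem_ball (hVU hθ).2
  have hmem := hγ.mapsTo hball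
  rw [evalExt_apply_of_mem hmem]
  refine hf _ ⟨q.den, q.den_pos, ?_⟩
  rw [← hΦφ, hγ.apply_eq _ hball, ← Complex.exp_nat_mul, Complex.exp_eq_one_iff]
  refine ⟨q.num, ?_⟩
  have h2 : (q.den : ℂ) * (q : ℂ) = q.num := by exact_mod_cast Rat.den_mul_eq_num q
  push_cast
  rw [← h2]
  ring

omit hΩ hconn hΦ hne h1 in
/-- In a chart, the vectors representing `f ↦ ∫ exp (i k θ) (θ - a)² (θ - b)² f (γ θ) dθ` form an
orbit, whose norms are `O(1 / k²)`. -/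
theorem exists_mem_summableOrbits (hφ : IsMultiplier H φ) {γ : ℂ → EuclideanSpace ℂ (Fin n)}
    {θ₀ r : ℝ} (hγ : IsUnimodularChart Ω Φ γ θ₀ r) {a b : ℝ} (ha : θ₀ - r < a) (hab : a < b)
    (hb : b < θ₀ + r) :
    ∃ x ∈ summableOrbits (ContinuousLinearMap.adjoint (mulOp φ hφ)), ∀ f : H,
      inner ℂ x f = ∫ θ in a..b, (((θ - a) ^ 2 * (θ - b) ^ 2 : ℝ) : ℂ) * evalExt H (γ θ) f := by
  have hball : ∀ θ ∈ Set.uIcc a b, (θ : ℂ) ∈ Metric.ball (θ₀ : ℂ) r := by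
    intro θ hθ
    rw [Set.uIcc_of_le hab.le] at hθ
    exact ofReal_mem_ball ⟨ha.trans_le hθ.1, hθ.2.trans_lt hb⟩
  have hdiff : ∀ f : H, DifferentiableOn ℂ (fun ζ => evalExt H (γ ζ) f)
      (Metric.ball (θ₀ : ℂ) r) := fun f =>
    (differentiableOn_evalExt (hH f)).comp hγ.differentiableOn hγ.mapsTo
  have hcont : ∀ f : H, ContinuousOn (fun θ : ℝ => evalExt H (γ θ) f) (Set.uIcc a b) := fun f =>
    (hdiff f).continuousOn.comp Complex.continuous_ofReal.continuousOn hball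
  -- The double zeros of the weight at `a` and `b` remove the boundary terms of both partial
  -- integrations.
  set c : ℤ → ℝ → ℂ := fun k θ => Complex.exp (θ * Complex.I) ^ k *
    (((θ - a) ^ 2 * (θ - b) ^ 2 : ℝ) : ℂ) with hc_def
  have hc : ∀ k, Continuous (c k) := fun k =>
    (Continuous.zpow₀ (by fun_prop) k fun θ => Or.inl (Complex.exp_ne_zero _)).mul (by fun_prop)
  choose L hL using fun k => exists_integral_functional (fun θ : ℝ => evalExt H (γ θ)) (c k) hcont
    (hc k).continuousOn
  have hbound : ∃ C, ∀ k : ℤ, ‖((k : ℂ) ^ 2) • L k‖ ≤ C := by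
    refine banach_steinhaus fun f => ?_
    have hω : ∀ ζ : ℂ, HasDerivAt (fun ζ : ℂ => (ζ - a) ^ 2 * (ζ - b) ^ 2)
        (2 * (ζ - a) * (ζ - b) ^ 2 + (ζ - a) ^ 2 * (2 * (ζ - b))) ζ := fun ζ => by
      have h2 := (((hasDerivAt_id ζ).sub_const (a : ℂ)).pow 2).mul
        (((hasDerivAt_id ζ).sub_const (b : ℂ)).pow 2)
      refine h2.congr_deriv ?_
      simp
    have hprod : ∀ ζ ∈ Metric.ball (θ₀ : ℂ) r,
        deriv (fun ζ : ℂ => (ζ - a) ^ 2 * (ζ - b) ^ 2 * evalExt H (γ ζ) f) ζ =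
        (2 * (ζ - a) * (ζ - b) ^ 2 + (ζ - a) ^ 2 * (2 * (ζ - b))) * evalExt H (γ ζ) f +
          (ζ - a) ^ 2 * (ζ - b) ^ 2 * deriv (fun ζ => evalExt H (γ ζ) f) ζ := fun ζ hζ =>
      ((hω ζ).mul ((hdiff f).differentiableAt
        (Metric.isOpen_ball.mem_nhds hζ)).hasDerivAt).deriv
    obtain ⟨C, hC⟩ := exists_bound_oscillatory_integral Metric.isOpen_ball
      (g := fun ζ : ℂ => (ζ - a) ^ 2 * (ζ - b) ^ 2 * evalExt H (γ ζ) f)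
      (DifferentiableOn.mul (by fun_prop) (hdiff f)) hball (by simp) (by simp)
      (by rw [hprod _ (hball a Set.left_mem_uIcc)]; simp)
      (by rw [hprod _ (hball b Set.right_mem_uIcc)]; simp)
    refine ⟨C, fun k => ?_⟩
    rw [smul_apply, hL, smul_eq_mul]
    refine le_of_eq_of_le ?_ (hC k)
    congr 2
    refine intervalIntegral.integral_congr fun θ _ => ?_
    simp only [hc_def]
    push_cast
    ring
  obtain ⟨C, hC⟩ := hbound
  refine ⟨(InnerProductSpace.toDual ℂ H).symm (L 0),
    ⟨fun k => (InnerProductSpace.toDual ℂ H).symm (L k), rfl, fun k => ?_, ?_⟩, fun f => ?_⟩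
  · refine ext_inner_right ℂ fun f => ?_
    rw [ContinuousLinearMap.adjoint_inner_left, InnerProductSpace.toDual_symm_apply,
      InnerProductSpace.toDual_symm_apply, hL, hL]
    refine intervalIntegral.integral_congr fun θ hθ => ?_
    have hmem := hγ.mapsTo (hball θ hθ)
    simp only [hc_def]
    rw [evalExt_apply_of_mem hmem, evalExt_apply_of_mem hmem, mulOp_apply, ← hΦφ,
      hγ.apply_eq _ (hball θ hθ), zpow_add_one₀ (Complex.exp_ne_zero _)]
    ring
  · refine Summable.of_norm_bounded_eventually (g := fun k : ℤ => C * (1 / (k : ℝ) ^ 2))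
      ((Real.summable_one_div_int_pow.2 one_lt_two).mul_left C) ?_
    filter_upwards [(Set.finite_singleton (0 : ℤ)).compl_mem_cofinite] with k hk
    have hk0 : (0 : ℝ) < (k : ℝ) ^ 2 := by
      have : (k : ℝ) ≠ 0 := Int.cast_ne_zero.2 hk
      positivity
    have h2 := hC k
    rw [norm_smul, norm_pow, Complex.norm_intCast, sq_abs] at h2
    rw [norm_norm, LinearIsometryEquiv.norm_map, mul_one_div, le_div_iff₀ hk0, mul_comm]
    exact h2
  · rw [InnerProductSpace.toDual_symm_apply, hL]
    simp [hc_def]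

theorem dense_summableOrbits (hφ : IsMultiplier H φ) :
    Dense (summableOrbits (ContinuousLinearMap.adjoint (mulOp φ hφ)) : Set H) := by
  rw [Submodule.dense_iff_topologicalClosure_eq_top, Submodule.topologicalClosure_eq_top_iff,
    Submodule.eq_bot_iff]
  intro f hf
  refine eq_zero_of_frequently_evalExt_eq_zero hΩ hconn hH hΦ hΦφ hne h1 f
    fun γ θ₀ r hγ => ?_
  have hcont : ContinuousOn (fun θ : ℝ => evalExt H (γ θ) f) (Set.Ioo (θ₀ - r) (θ₀ + r)) :=
    ((differentiableOn_evalExt (hH f)).comp hγ.differentiableOn hγ.mapsTo).continuousOn.comp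
      Complex.continuous_ofReal.continuousOn fun θ hθ => ofReal_mem_ball hθ
  have hzero := eq_zero_of_forall_weighted_integral_eq_zero hcont fun a b ha hab hb => by
    obtain ⟨x, hx, hxf⟩ := exists_mem_summableOrbits hH hΦφ hφ hγ ha hab hb
    rw [← hxf]
    exact (Submodule.mem_orthogonal _ _).1 hf x hx
  refine Eventually.frequently (nhdsWithin_le_nhds ?_)
  filter_upwards [Ioo_mem_nhds (show θ₀ - r < θ₀ by linarith [hγ.pos])
    (show θ₀ < θ₀ + r by linarith [hγ.pos])] with θ hθ using hzero θ hθ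

omit hΩ hconn hΦ hΦφ hne h1 in
/-- A Hilbert space of continuous functions on a separable space is separable: the kernels at the
points of a countable dense set span a dense subspace. -/
theorem separableSpace_of_isHolomorphic : TopologicalSpace.SeparableSpace H := by
  obtain ⟨s, hs, hsd⟩ := TopologicalSpace.exists_countable_dense Ω
  have hdense := dense_span_kernelAt (H := H) (s := s) fun f hf => by
    refine RKHS.ext fun z => ?_
    rw [RKHS.coe_zero, Pi.zero_apply]
    exact congrFun ((hH f).continuous.ext_on hsd continuous_const
      (g := fun _ => 0) fun z hz => hf z hz) z
  have hsep := ((hs.image (kernelAt H)).isSeparable.span (R := ℂ)).closure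
  rw [hdense.closure_eq] at hsep
  exact TopologicalSpace.isSeparable_univ_iff.1 hsep

end Evaluation

end LinDyn

theorem propositionp {n : ℕ} (Ω : Set (EuclideanSpace ℂ (Fin n)))
    (hΩ_open : IsOpen Ω) (hΩ_conn : IsConnected Ω)
    (H : Type*) [NormedAddCommGroup H] [InnerProductSpace ℂ H] [CompleteSpace H] [Nontrivial H]
    [RKHS ℂ H Ω ℂ]
    (hH : ∀ f : H, LinDyn.IsHolomorphic Ω (fun z : Ω => f z))
    (hmul : ∀ ψ : Ω → ℂ, LinDyn.IsNonconstBddHolomorphic Ω ψ → LinDyn.IsMultiplier H ψ)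
    (hnorm : ∀ (ψ : Ω → ℂ) (hψ : LinDyn.IsNonconstBddHolomorphic Ω ψ),
      ‖LinDyn.mulOp ψ (hmul ψ hψ)‖ = ⨆ z : Ω, ‖ψ z‖)
    (φ : Ω → ℂ) (hφ : LinDyn.IsNonconstBddHolomorphic Ω φ) :
    List.TFAE [
      LinDyn.TopologicallyMultiplyRecurrent
        (ContinuousLinearMap.adjoint (LinDyn.mulOp φ (hmul φ hφ))),
      LinDyn.Recurrent (ContinuousLinearMap.adjoint (LinDyn.mulOp φ (hmul φ hφ))),
      LinDyn.FrequentlyHypercyclic (ContinuousLinearMap.adjoint (LinDyn.mulOp φ (hmul φ hφ))),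
      LinDyn.Hypercyclic (ContinuousLinearMap.adjoint (LinDyn.mulOp φ (hmul φ hφ))),
      (Set.range φ ∩ Metric.sphere (0 : ℂ) 1).Nonempty,
      LinDyn.HasPropertyA (ContinuousLinearMap.adjoint (LinDyn.mulOp φ (hmul φ hφ)))] := by
  obtain ⟨Φ, hΦ, hΦφ⟩ := hφ.holomorphic
  have huni : (Set.range φ ∩ Metric.sphere (0 : ℂ) 1).Nonempty → ∃ z, ‖φ z‖ = 1 := by
    rintro ⟨_, ⟨z, rfl⟩, hz⟩
    exact ⟨z, mem_sphere_zero_iff_norm.1 hz⟩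
  have hperiodic := fun h => LinDyn.dense_periodic hΩ_open hΩ_conn.isPreconnected hH hΦ hΦφ
    hφ.nonconstant (huni h) (hmul φ hφ)
  tfae_have 1 → 2 := LinDyn.TopologicallyMultiplyRecurrent.recurrent
  tfae_have 2 → 5 := fun h => by
    obtain ⟨z, hz⟩ := LinDyn.exists_unimodular_value_of_recurrent hΩ_conn hmul hnorm hφ h
    exact ⟨φ z, ⟨z, rfl⟩, mem_sphere_zero_iff_norm.2 hz⟩
  tfae_have 5 → 1 := fun h =>
    LinDyn.topologicallyMultiplyRecurrent_of_dense_periodic (hperiodic h)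
  tfae_have 5 → 6 := fun h => LinDyn.hasPropertyA_of_dense_periodic (hperiodic h)
  tfae_have 6 → 2 := LinDyn.HasPropertyA.recurrent
  tfae_have 5 → 3 := fun h => by
    have := LinDyn.separableSpace_of_isHolomorphic hH
    exact LinDyn.frequentlyHypercyclic_of_dense_summableOrbits
      (LinDyn.dense_summableOrbits hΩ_open hΩ_conn.isPreconnected hH hΦ hΦφ hφ.nonconstant
        (huni h) (hmul φ hφ))
  tfae_have 3 → 4 := LinDyn.FrequentlyHypercyclic.hypercyclic
  tfae_have 4 → 2 := LinDyn.Hypercyclic.recurrent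
  tfae_finish
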